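/- **Setting.** Let $p_0,p_1,p_2\in\mathbb R^2$ be the vertices of an equilateral triangle of side length one, $F_i(x)=\frac12(x-p_i)+p_i$, $F_w=F_{w_1}\circ\dots\circ F_{w_m}$ for a word $w\in\{0,1,2\}^m$, $\mathrm{SG}$ the Sierpinski gasket (the nonempty compact set with $\mathrm{SG}=\bigcup_iF_i(\mathrm{SG})$), $V_0=\{p_0,p_1,p_2\}$, $V_m=\bigcup_{|w|=m}F_w(V_0)$, and $\mu$ the self-similar probability measure with $\mu(F_w(\mathrm{SG}))=3^{-|w|}$. All $L^q$ norms are taken with respect to $\mu$. Let $\mathcal E(u)=\lim_{m\to\infty}(5/3)^m\,\frac12\sum_{p\sim_mq}(u(p)-u(q))^2$ (sum over ordered pairs of neighbours in $V_m$), extended to a bilinear form by polarization. Let $\mathcal F$ be the set of continuous functions on $\mathrm{SG}$ with $\mathcal E(u)<\infty$ and $\mathcal F_0=\{u\in\mathcal F:u|_{V_0}=0\}$. A Neumann (Dirichlet) eigenfunction with eigenvalue $\lambda$ is a nonzero $u$ in $\mathcal F$ (in $\mathcal F_0$) with $\mathcal E(u,v)=\lambda\int uv\,d\mu$ for all $v$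 in $\mathcal F$ (in $\mathcal F_0$). For $s>0$ let $\|u\|_{H^s}=\|(I-\Delta_N)^{s/2}u\|_{L^2}=\big(\sum_{\lambda}(1+\lambda)^s\|P_\lambda u\|_{L^2}^2\big)^{1/2}$, where $P_\lambda$ is the orthogonal projection of $L^2(\mathrm{SG},\mu)$ onto the Neumann eigenspace at $\lambda$; $\|u\|_{H^s_0}$ is defined in the same way with the Dirichlet eigenspaces. Let $d_S=\frac{\log 9}{\log 5}$ and $\sigma_q=\frac{d_S}2\big(1-\frac2q\big)$. For $c>0$ and $j\ge2$, a *localized eigenfunction of generation $j$* (with constant $c$) is a function $\psi$ that is both a Neumann and a Dirichlet eigenfunction with eigenvalue $\lambda_\psi=c\,5^j$ and satisfies $\|\psi\|_{L^2}=1$ and $3^{-j}\le\frac12\mu(\operatorname{supp}\psi)\le3^{-j+1}$. The standard family $\psi^{(j)}$, $j\ge2$, is the following. Let $p=\frac12(p_a+p_b)\in V_1\setminus V_0$ ($a\ne b$), and let $w=ab\cdots b$, $w'=ba\cdots a$ be the words of length $j-1$ with $\{p\}=F_w(\mathrm{SG})\cap F_{w'}(\mathrm{SG})$. On $V_j$ let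 $v$ be $2$ at $p$; in each of the two cells $F_w(V_1)$, $F_{w'}(V_1)$ let it be $-1$ at the midpoints of the two sides ending at $p$ and $1$ at the midpoint of the opposite side; and let it be $0$ at all other points of $V_j$. Put $\lambda_j=6$, $\lambda_{j+1}=3$ and $\lambda_{m+1}=\frac12\big(5-\sqrt{25-4\lambda_m}\big)$ for $m>j$. Let $\psi_j$ be the continuous function on $\mathrm{SG}$ with $\psi_j=v$ on $V_j$ such that, for every $m\ge j$ and every cell of level $m$ with corners $x,y,z$, its value at the midpoint of $x,y$ is $\frac{(4-\lambda_{m+1})(\psi_j(x)+\psi_j(y))+2\psi_j(z)}{(2-\lambda_{m+1})(5-\lambda_{m+1})}$. Let $\psi^{(j)}=\psi_j/\|\psi_j\|_{L^2}$. **Theorem.** (a) The functions $\psi_j$ exist for every $j\ge2$ and every choice of $p\in V_1\setminus V_0$, and there is one constant $c_6>0$ such that every $\psi^{(j)}$ is a localized eigenfunction of generation $j$ with constant $c_6$; in particular $\lambda_{\psi^{(j)}}=c_65^j$. (b) Let $c>0$ and $q=2k>2$ with $k\in\mathbb N$. There are constants $C_0=C_0(c)$ and $C=C(c,q)$ such that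 for every $j\ge2$ and every localized eigenfunction $\psi$ of generation $j$ with constant $c$ (in particular, for $c=c_6$, for every $\psi^{(j)}$), $$C^{-1}\|\psi\|_{H^{\sigma_q}}\le\|\psi\|_{L^q}\le C\,\|\psi\|_{H^{\sigma_q}},\qquad C_0^{-1}\lambda_\psi^{\sigma_q/2}\le\|\psi\|_{H^{\sigma_q}}\le C_0\,\lambda_\psi^{\sigma_q/2},\qquad \lambda_\psi=c\,5^j,$$ and the same holds with $\|\cdot\|_{H^{\sigma_q}_0}$ in place of $\|\cdot\|_{H^{\sigma_q}}$. Thus the embedding $H^{\sigma_q}(\mathrm{SG})\subseteq L^q(\mathrm{SG})$ is saturated by these functions, for the Neumann and the Dirichlet norms. -/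

import Mathlib

open MeasureTheory Filter
open scoped ENNReal NNReal

noncomputable section

namespace Gasket

/-- The Euclidean plane. -/
abbrev Plane : Type := EuclideanSpace ℝ (Fin 2)

/-- The vertices `p₀, p₁, p₂` of an equilateral triangle of side length one; they form `V₀`. -/
def vertex : Fin 3 → Plane := ![!₂[0, 0], !₂[1, 0], !₂[1 / 2, Real.sqrt 3 / 2]]

/-- The contraction `F_i(x) = (x - p_i) / 2 + p_i`. -/
def contr (i : Fin 3) (x : Plane) : Plane := (1 / 2 : ℝ) • (x - vertex i) + vertex i

/-- `cell w = F_{w₁} ∘ ⋯ ∘ F_{w_m}` for a word `w = w₁ … w_m`. -/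
def cell : List (Fin 3) → Plane → Plane
  | [] => id
  | i :: w => contr i ∘ cell w

/-- The coding map `ω ↦ lim_n F_{ω₀} ∘ ⋯ ∘ F_{ω_n}(0) = ∑_n 2^{-(n+1)} p_{ω_n}`. -/
def code (ω : ℕ → Fin 3) : Plane := ∑' n, ((1 / 2 : ℝ) ^ (n + 1)) • vertex (ω n)

/-- The Sierpinski gasket, the image of the coding map; it is the only nonempty compact set `K`
with `K = F₀(K) ∪ F₁(K) ∪ F₂(K)`. -/
def SG : Set Plane := Set.range code

/-- The uniform probability measure on the three letters. -/
abbrev letterMeasure : Measure (Fin 3) := (PMF.uniformOfFintype (Fin 3)).toMeasure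

/-- The self-similar Bernoulli probability measure on the gasket, which gives mass `3^{-m}` to every
cell `F_w(SG)` with `w` of length `m`: the law of `code ω` for independent uniform letters. -/
def mu : Measure Plane := (Measure.infinitePi fun _ : ℕ => letterMeasure).map code

/-- The graph energy `𝓔_m(u) = (1/2) ∑_{p ∼_m q} (u(p) - u(q))²`, over ordered pairs of neighbours.
Two points of `V_m` are neighbours when they are distinct corners of a common cell of level `m`, and
this cell is then unique, so that the sum is taken cell by cell. -/
def graphEnergy (m : ℕ) (u : Plane → ℝ) : ℝ :=
  ∑ w : Fin m → Fin 3, (1 / 2 : ℝ) * ∑ i : Fin 3, ∑ k : Fin 3,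
    (u (cell (List.ofFn w) (vertex i)) - u (cell (List.ofFn w) (vertex k))) ^ 2

/-- The energy `𝓔(u) = lim_m (5/3)^m 𝓔_m(u) ∈ [0, ∞]`. The sequence is nondecreasing, so that its
limit is its supremum. -/
def energy (u : Plane → ℝ) : ℝ≥0∞ := ⨆ m : ℕ, ENNReal.ofReal ((5 / 3 : ℝ) ^ m * graphEnergy m u)

/-- The bilinear form `𝓔(u, v)`, by polarization (meaningful when the energies are finite). -/
def energyForm (u v : Plane → ℝ) : ℝ :=
  ((energy (u + v)).toReal - (energy (u - v)).toReal) / 4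

/-- The Neumann domain `𝓕`: functions that are continuous on the gasket and have finite energy.
The values of a function off the gasket are irrelevant throughout. -/
def neumannDomain : Set (Plane → ℝ) := {u | ContinuousOn u SG ∧ energy u ≠ ⊤}

/-- The Dirichlet domain `𝓕₀`: the functions of `𝓕` that vanish on `V₀`. -/
def dirichletDomain : Set (Plane → ℝ) := {u | u ∈ neumannDomain ∧ ∀ i, u (vertex i) = 0}

/-- The weak eigenvalue equation `-Δ u = lam u`, for the Laplacian of the energy form with domain
`D`: `u ∈ D` and `𝓔(u, v) = lam ⟨u, v⟩` for all `v ∈ D`. (The zero function is not excluded.) -/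
def SolvesEigenEq (D : Set (Plane → ℝ)) (lam : ℝ) (u : Plane → ℝ) : Prop :=
  u ∈ D ∧ ∀ v ∈ D, energyForm u v = lam * ∫ x, u x * v x ∂mu

/-- The closed eigenspace in `L²(SG, μ)` of the Laplacian with form domain `D` at `lam`. -/
def eigenspace (D : Set (Plane → ℝ)) (lam : ℝ) : Submodule ℝ (Lp ℝ 2 mu) :=
  (Submodule.span ℝ {f : Lp ℝ 2 mu | ∃ u, SolvesEigenEq D lam u ∧ f =ᵐ[mu] u}).topologicalClosure

instance (D : Set (Plane → ℝ)) (lam : ℝ) : (eigenspace D lam).HasOrthogonalProjection := by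
  unfold eigenspace
  infer_instance

open Classical in
/-- The fractional Sobolev norm `‖(I - Δ)^{s/2} u‖_{L²}` for the Laplacian with form domain `D`.
Since the spectrum is a pure point spectrum in `[0, ∞)`, it is given by
`‖u‖² = ∑_φ (1 + lam_φ)^s |⟨φ, u⟩|²` for an orthonormal basis `φ` of eigenfunctions; grouped by
eigenvalues, this is `∑_lam (1 + lam)^s ‖P_lam u‖²` with `P_lam` the orthogonal projection onto the
eigenspace at `lam` (which is zero when `lam` is not an eigenvalue). -/
def sobolevNorm (D : Set (Plane → ℝ)) (s : ℝ) (u : Plane → ℝ) : ℝ≥0∞ :=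
  if h : MemLp u 2 mu then
    (∑' lam : ℝ≥0, (1 + (lam : ℝ≥0∞)) ^ s *
      ‖(eigenspace D lam).starProjection (h.toLp u)‖ₑ ^ 2) ^ (1 / 2 : ℝ)
  else ⊤

/-- The spectral dimension of the gasket. -/
def spectralDim : ℝ := Real.log 9 / Real.log 5

/-- The exponent `σ_q = (d_S / 2) (1 - 2 / q)`. -/
def sobolevExp (q : ℝ) : ℝ := spectralDim / 2 * (1 - 2 / q)

/-- The support of `u` in the gasket. -/
def support (u : Plane → ℝ) : Set Plane := closure {x | x ∈ SG ∧ u x ≠ 0}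

/-- `ψ` is a localized eigenfunction of generation `j`: it is a Neumann and a Dirichlet
eigenfunction, normalized in `L²`, with eigenvalue `c 5^j`, and `3^{-j} ≤ μ(supp ψ) / 2 ≤ 3^{-j+1}`.
-/
structure IsLocalizedEigenfunction (c : ℝ) (j : ℕ) (ψ : Plane → ℝ) : Prop where
  neumann : SolvesEigenEq neumannDomain (c * 5 ^ j) ψ
  dirichlet : SolvesEigenEq dirichletDomain (c * 5 ^ j) ψ
  norm_eq : eLpNorm ψ 2 mu = 1
  le_support : (3 : ℝ) ^ (-(j : ℤ)) ≤ 1 / 2 * mu.real (support ψ)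
  support_le : 1 / 2 * mu.real (support ψ) ≤ (3 : ℝ) ^ (-(j : ℤ) + 1)

/-- The eigenvalues of the graph Laplacians `u ↦ ∑_{y ∼ x} (u(x) - u(y))` on `V_j, V_{j+1}, …` that
spectral decimation produces from `6`: the first continuation is `3`, the larger root of
`t (5 - t) = 6` (the other root `2` is a forbidden value), and each later one is the smaller
root of `t (5 - t) = (previous eigenvalue)`. -/
def decimationEigenvalue : ℕ → ℝ
  | 0 => 6
  | 1 => 3
  | n + 2 => (5 - Real.sqrt (25 - 4 * decimationEigenvalue (n + 1))) / 2

/-- Initial values in one of the two cells of level `j - 1` that meet at the vertex `p`, where `p` is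
the corner with label `b` of the cell: `2` at `p`, `-1` at the midpoints of the two sides that end
at `p`, `1` at the midpoint of the opposite side, `0` at the other two corners. The point is the
midpoint of the corners `i` and `k`. -/
def seed (b i k : Fin 3) : ℝ :=
  if i = k then (if i = b then 2 else 0) else (if i = b ∨ k = b then -1 else 1)

/-- `u` is the function obtained by spectral decimation from the localized eigenfunction of the graph
Laplacian on `V_j` with eigenvalue `6` around the point `p = (p_a + p_b) / 2` of `V₁ \ V₀`.
The two cells of level `j - 1` at `p` have the words `a b … b` and `b a … a`. -/
structure IsDecimationFunction (j : ℕ) (a b : Fin 3) (u : Plane → ℝ) : Prop where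
  continuousOn : ContinuousOn u SG
  initial : ∀ w : List (Fin 3), w.length = j - 1 → ∀ i k : Fin 3,
    u (cell w (midpoint ℝ (vertex i) (vertex k))) =
      if w = a :: List.replicate (j - 2) b then seed b i k
      else if w = b :: List.replicate (j - 2) a then seed a i k
      else 0
  extension : ∀ n : ℕ, ∀ w : List (Fin 3), w.length = j + n →
    ∀ i k l : Fin 3, i ≠ k → k ≠ l → i ≠ l →
      u (cell w (midpoint ℝ (vertex i) (vertex k))) =
        ((4 - decimationEigenvalue (n + 1)) * (u (cell w (vertex i)) + u (cell w (vertex k)))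
            + 2 * u (cell w (vertex l)))
          / ((2 - decimationEigenvalue (n + 1)) * (5 - decimationEigenvalue (n + 1)))

/-- `u / ‖u‖_{L²}`. -/
def normalized (u : Plane → ℝ) : Plane → ℝ := fun x => u x / (eLpNorm u 2 mu).toReal

/-- `a` and `b` agree up to the factor `C` in both directions. -/
def Comparable (C : ℝ≥0) (a b : ℝ≥0∞) : Prop := a ≤ C * b ∧ b ≤ C * a

end Gasket

end

open Topology

namespace Gasket

/-! For (b), write e = 1/2 - 1/q. Since 5^{d_S/2} = 3, the power (c 5^j)^{σ_q/2} is a constant times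
3^{je} (`rpow_sobolevExp`), so everything is compared with 3^{je}. An eigenfunction has a single
spectral component, and its Sobolev norm is (1 + λ)^{σ_q/2} exactly (`sobolevNorm_eq`). A function
of finite energy oscillates on a cell of level m by at most a constant times (3/5)^{m/2} 𝓔(u)^{1/2};
averaging over a cell of level m = j and inserting 𝓔(ψ) = c 5^j gives sup ψ² ≤ B 3^j
(`exists_sq_le_of_eigen`). Interpolation between L² and L^∞ is then the upper bound for the L^q
norm, and Hölder's inequality on the support, of measure at most 6 · 3^{-j}, is the lower bound.

For (a), the eigenvalue equation is tested cell by cell. At a corner of a cell the equation leaves a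
one-sided `defect`, and a single step of spectral decimation multiplies the sum of the defects
against any test function by a constant (`sum_defect_spectralExtension`). At level j with eigenvalue
6 all defects vanish, because the seed has sum zero over the corners of every cell of level j. Hence
the weak equation holds at all later levels and against every function, with no boundary term, which
yields the Neumann and the Dirichlet equation together. In the limit the eigenvalue is (3/2) L 5^j
with L = lim 5^n λ_{j+n}.

Existence is proved on the space of codes. The corner values of the nested cells along a sequence
converge uniformly, because the spectral extension contracts oscillations by 3/5 up to an error
proportional to the rapidly decaying eigenvalue (`abs_cornerValue_sub_le`). The limit takes the same
value at the two codes of a junction point (`codeValue_eq_of_junction`), so it descends to the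
gasket. The support consists of the two cells at p because corner values that are not all zero on a
cell are not all zero on any of its subcells (`eq_zero_of_spectralExtension`). -/

/-! ### Cells, words and the coding map -/

lemma contr_eq (i : Fin 3) (x : Plane) :
    contr i x = (1 / 2 : ℝ) • x + (1 / 2 : ℝ) • vertex i := by
  unfold contr
  module

@[simp] lemma contr_vertex (i : Fin 3) : contr i (vertex i) = vertex i := by
  simp [contr]

lemma contr_vertex_comm (i k : Fin 3) : contr i (vertex k) = contr k (vertex i) := by
  simp only [contr_eq]
  module

lemma midpoint_vertex (i k : Fin 3) : midpoint ℝ (vertex i) (vertex k) = contr i (vertex k) := by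
  rw [contr_eq, midpoint_eq_smul_add, invOf_eq_inv]
  module

lemma continuous_contr (i : Fin 3) : Continuous (contr i) := by
  unfold contr
  fun_prop

@[simp] lemma cell_nil (x : Plane) : cell [] x = x := rfl

@[simp] lemma cell_cons (i : Fin 3) (w : List (Fin 3)) (x : Plane) :
    cell (i :: w) x = contr i (cell w x) := rfl

lemma cell_append (w w' : List (Fin 3)) (x : Plane) : cell (w ++ w') x = cell w (cell w' x) := by
  induction w with
  | nil => rfl
  | cons i w ih => simp [ih]

lemma cell_concat (w : List (Fin 3)) (i : Fin 3) (x : Plane) :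
    cell (w ++ [i]) x = cell w (contr i x) := by
  rw [cell_append]; rfl

lemma cell_sub (w : List (Fin 3)) (x y : Plane) :
    cell w x - cell w y = ((1 / 2 : ℝ) ^ w.length) • (x - y) := by
  induction w with
  | nil => simp
  | cons i w ih =>
    have : contr i (cell w x) - contr i (cell w y) = (1 / 2 : ℝ) • (cell w x - cell w y) := by
      simp only [contr_eq]; module
    rw [cell_cons, cell_cons, this, ih, smul_smul, List.length_cons, pow_succ']

/-- The word formed by the first `n` letters of a sequence. -/
def initialWord (ω : ℕ → Fin 3) (n : ℕ) : List (Fin 3) := List.ofFn fun k : Fin n => ω k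

@[simp] lemma length_initialWord (ω : ℕ → Fin 3) (n : ℕ) : (initialWord ω n).length = n := by
  simp [initialWord]

lemma initialWord_succ (ω : ℕ → Fin 3) (n : ℕ) :
    initialWord ω (n + 1) = initialWord ω n ++ [ω n] := by
  rw [initialWord, List.ofFn_succ', List.concat_eq_append]
  rfl

lemma initialWord_succ' (ω : ℕ → Fin 3) (n : ℕ) :
    initialWord ω (n + 1) = ω 0 :: initialWord (fun k => ω (k + 1)) n := by
  simp [initialWord, List.ofFn_succ]

lemma initialWord_eq_iff {ω ω' : ℕ → Fin 3} {n : ℕ} :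
    initialWord ω n = initialWord ω' n ↔ ∀ k < n, ω k = ω' k := by
  constructor
  · intro h k hk
    have := congrFun (List.ofFn_injective h) ⟨k, hk⟩
    simpa using this
  · intro h
    unfold initialWord
    congr 1
    ext k
    rw [h k k.2]

/-- The sequence that continues a word by a constant letter. -/
def constTail (w : List (Fin 3)) (i : Fin 3) : ℕ → Fin 3 := fun n => w.getD n i

lemma initialWord_constTail_append (w w' : List (Fin 3)) (i : Fin 3) :
    initialWord (constTail (w ++ w') i) w.length = w := by
  apply List.ext_getElem
  · simp
  · intro n _ _
    simp [initialWord, constTail, List.getElem?_append_left]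

lemma initialWord_constTail (w : List (Fin 3)) (i : Fin 3) :
    initialWord (constTail w i) w.length = w := by
  simpa using initialWord_constTail_append w [] i

lemma constTail_of_le {w : List (Fin 3)} {n : ℕ} (h : w.length ≤ n) (i : Fin 3) :
    constTail w i n = i := by
  simp [constTail, h]

lemma constTail_initialWord_of_lt (ω : ℕ → Fin 3) {n k : ℕ} (h : k < n) (i : Fin 3) :
    constTail (initialWord ω n) i k = ω k := by
  simp [constTail, initialWord, List.getD_eq_getElem?_getD, h]

lemma norm_vertex_le (i : Fin 3) : ‖vertex i‖ ≤ 1 := by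
  have h : Real.sqrt 3 ^ 2 = 3 := Real.sq_sqrt (by norm_num)
  fin_cases i
  · simp [vertex, EuclideanSpace.norm_eq]
  · simp [vertex, EuclideanSpace.norm_eq]
  · simp [vertex, EuclideanSpace.norm_eq, div_pow, h]
    norm_num

lemma norm_code_term_le (ω : ℕ → Fin 3) (n : ℕ) :
    ‖((1 / 2 : ℝ) ^ (n + 1)) • vertex (ω n)‖ ≤ (1 / 2 : ℝ) ^ (n + 1) := by
  rw [norm_smul, Real.norm_of_nonneg (by positivity)]
  exact mul_le_of_le_one_right (by positivity) (norm_vertex_le _)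

lemma summable_half_pow_succ : Summable fun n : ℕ => (1 / 2 : ℝ) ^ (n + 1) :=
  (summable_nat_add_iff 1).2 summable_geometric_two

lemma tsum_half_pow_succ : ∑' n : ℕ, (1 / 2 : ℝ) ^ (n + 1) = 1 := by
  simp_rw [pow_succ]
  rw [tsum_mul_right, tsum_geometric_two]
  norm_num

lemma summable_code (ω : ℕ → Fin 3) :
    Summable fun n => ((1 / 2 : ℝ) ^ (n + 1)) • vertex (ω n) :=
  Summable.of_norm_bounded summable_half_pow_succ (norm_code_term_le ω)

lemma continuous_code : Continuous code := by
  refine continuous_tsum (fun n => ?_) summable_half_pow_succ (fun n ω => norm_code_term_le ω n)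
  have : Continuous (vertex : Fin 3 → Plane) := continuous_of_discreteTopology
  have h : Continuous fun ω : ℕ → Fin 3 => vertex (ω n) := this.comp (continuous_apply n)
  exact h.const_smul ((1 / 2 : ℝ) ^ (n + 1))

lemma isCompact_SG : IsCompact SG := isCompact_range continuous_code

lemma code_mem_SG (ω : ℕ → Fin 3) : code ω ∈ SG := ⟨ω, rfl⟩

lemma code_shift (ω : ℕ → Fin 3) : code ω = contr (ω 0) (code fun n => ω (n + 1)) := by
  rw [contr_eq, code, (summable_code ω).tsum_eq_zero_add, code, ← tsum_const_smul'', add_comm]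
  congr 1
  · congr 1
    ext1 n
    rw [smul_smul, pow_succ' _ (n + 1)]
  · simp

lemma code_eq_cell (n : ℕ) (ω : ℕ → Fin 3) :
    code ω = cell (initialWord ω n) (code fun k => ω (n + k)) := by
  induction n generalizing ω with
  | zero => simp [initialWord]
  | succ n ih =>
    rw [initialWord_succ', cell_cons, code_shift, ih]
    simp only [add_assoc, add_comm, add_left_comm]

lemma code_const (i : Fin 3) : code (fun _ => i) = vertex i := by
  unfold code
  rw [summable_half_pow_succ.tsum_smul_const]
  rw [tsum_half_pow_succ, one_smul]

lemma code_constTail (w : List (Fin 3)) (i : Fin 3) :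
    code (constTail w i) = cell w (vertex i) := by
  rw [code_eq_cell w.length, initialWord_constTail]
  congr 1
  rw [← code_const]
  congr 1
  ext1 k
  exact constTail_of_le (by omega) i

lemma cell_vertex_mem_SG (w : List (Fin 3)) (i : Fin 3) : cell w (vertex i) ∈ SG :=
  code_constTail w i ▸ code_mem_SG _

lemma cell_replicate_vertex (n : ℕ) (i : Fin 3) :
    cell (List.replicate n i) (vertex i) = vertex i := by
  induction n with
  | zero => rfl
  | succ n ih => rw [List.replicate_succ, cell_cons, ih, contr_vertex]

lemma norm_code_le (ω : ℕ → Fin 3) : ‖code ω‖ ≤ 1 := by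
  rw [← tsum_half_pow_succ]
  exact tsum_of_norm_bounded summable_half_pow_succ.hasSum (norm_code_term_le ω)

lemma dist_code_cell_le (ω : ℕ → Fin 3) (n : ℕ) (i : Fin 3) :
    dist (code ω) (cell (initialWord ω n) (vertex i)) ≤ 2 * (1 / 2 : ℝ) ^ n := by
  rw [code_eq_cell n, dist_eq_norm, cell_sub, norm_smul, length_initialWord,
    Real.norm_of_nonneg (by positivity), mul_comm]
  gcongr
  calc _ ≤ _ := norm_sub_le _ _
    _ ≤ 1 + 1 := add_le_add (norm_code_le _) (norm_vertex_le _)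
    _ = 2 := by norm_num

lemma tendsto_two_mul_half_pow : Tendsto (fun n : ℕ => 2 * (1 / 2 : ℝ) ^ n) atTop (𝓝 0) := by
  simpa using (tendsto_pow_atTop_nhds_zero_of_lt_one (r := (1 / 2 : ℝ)) (by norm_num)
    (by norm_num)).const_mul 2

lemma tendsto_cell_initialWord (ω : ℕ → Fin 3) (i : Fin 3) :
    Tendsto (fun n => cell (initialWord ω n) (vertex i)) atTop (𝓝[SG] (code ω)) := by
  refine tendsto_nhdsWithin_iff.2 ⟨?_, Eventually.of_forall fun n => cell_vertex_mem_SG _ i⟩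
  rw [tendsto_iff_dist_tendsto_zero]
  refine squeeze_zero (fun _ => dist_nonneg) (fun n => ?_) tendsto_two_mul_half_pow
  rw [dist_comm]
  exact dist_code_cell_le ω n i

/-! ### Junction points and functions on the space of codes -/

/-- The `l`-th barycentric coordinate of `code ω` with respect to the triangle. -/
noncomputable def baryCode (l : Fin 3) (ω : ℕ → Fin 3) : ℝ :=
  ∑' n, (1 / 2 : ℝ) ^ (n + 1) * (if ω n = l then 1 else 0)

lemma exists_bary (l : Fin 3) : ∃ f : Plane →L[ℝ] ℝ, ∃ d : ℝ, ∀ i, f (vertex i) + d =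
    if i = l then 1 else 0 := by
  have h3 : Real.sqrt 3 ≠ 0 := by positivity
  have e : ∀ k : Fin 2, ∀ v, (EuclideanSpace.proj k : Plane →L[ℝ] ℝ) v = v k := fun _ _ => rfl
  fin_cases l
  · refine ⟨-(EuclideanSpace.proj (0 : Fin 2)) - (1 / Real.sqrt 3) • EuclideanSpace.proj (1 : Fin 2),
      1, fun i => ?_⟩
    fin_cases i <;> simp [vertex, e]
    field_simp; norm_num
  · refine ⟨(EuclideanSpace.proj (0 : Fin 2)) - (1 / Real.sqrt 3) • EuclideanSpace.proj (1 : Fin 2),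
      0, fun i => ?_⟩
    fin_cases i <;> simp [vertex, e]
    field_simp; norm_num
  · refine ⟨(2 / Real.sqrt 3) • EuclideanSpace.proj (1 : Fin 2), 0, fun i => ?_⟩
    fin_cases i <;> simp [vertex, e]

lemma summable_bary (l : Fin 3) (ω : ℕ → Fin 3) :
    Summable fun n => (1 / 2 : ℝ) ^ (n + 1) * (if ω n = l then 1 else 0) := by
  refine summable_half_pow_succ.of_nonneg_of_le (fun n => ?_) (fun n => ?_)
  · positivity
  · exact mul_le_of_le_one_right (by positivity) (by split_ifs <;> norm_num)

lemma baryCode_eq_of_code_eq {ω ω' : ℕ → Fin 3} (h : code ω = code ω') (l : Fin 3) :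
    baryCode l ω = baryCode l ω' := by
  obtain ⟨f, d, hf⟩ := exists_bary l
  have key : ∀ η : ℕ → Fin 3, baryCode l η = f (code η) + d := by
    intro η
    -- The weights 2^{-(n+1)} sum to 1, so the affine function f + d passes through the series.
    have h1 : ∑' n : ℕ, (1 / 2 : ℝ) ^ (n + 1) * d = d := by
      rw [tsum_mul_right, tsum_half_pow_succ, one_mul]
    rw [code, f.map_tsum (summable_code η)]
    conv_rhs => rw [← h1]
    rw [← Summable.tsum_add ((summable_code η).mapL f) (summable_half_pow_succ.mul_right d)]
    refine tsum_congr fun n => ?_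
    rw [map_smul, smul_eq_mul, ← mul_add, hf]
  rw [key, key, h]

lemma baryCode_zero_add (l : Fin 3) (ω : ℕ → Fin 3) :
    baryCode l ω = (1 / 2) * (if ω 0 = l then 1 else 0) +
      (1 / 2) * baryCode l (fun n => ω (n + 1)) := by
  rw [baryCode, (summable_bary l ω).tsum_eq_zero_add, baryCode, ← tsum_mul_left]
  congr 1
  · simp
  · refine tsum_congr fun n => ?_
    rw [pow_succ' _ (n + 1), mul_assoc]

lemma baryCode_nonneg (l : Fin 3) (ω : ℕ → Fin 3) : 0 ≤ baryCode l ω :=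
  tsum_nonneg fun n => by positivity

lemma baryCode_le_one (l : Fin 3) (ω : ℕ → Fin 3) : baryCode l ω ≤ 1 := by
  rw [← tsum_half_pow_succ]
  refine (summable_bary l ω).tsum_le_tsum (fun n => ?_) summable_half_pow_succ
  exact mul_le_of_le_one_right (by positivity) (by split_ifs <;> norm_num)

/-- The coordinate is the mean of the indicator of the first letter and the coordinate of the
shifted sequence. Both are at most 1, so both must be 1. -/
lemma eq_of_one_le_baryCode {l : Fin 3} {ω : ℕ → Fin 3} (h : 1 ≤ baryCode l ω) (n : ℕ) :
    ω n = l := by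
  induction n generalizing ω with
  | zero =>
    by_contra h0
    have := baryCode_zero_add l ω
    rw [if_neg h0] at this
    linarith [baryCode_le_one l (fun n => ω (n + 1))]
  | succ n ih =>
    apply ih (ω := fun n => ω (n + 1))
    have := baryCode_zero_add l ω
    split_ifs at this <;> linarith

/-- Two sequences with distinct first letters that code the same point end in the other letter. -/
lemma code_eq_of_ne_zero {ω ω' : ℕ → Fin 3} (h : code ω = code ω') (h0 : ω 0 ≠ ω' 0) (n : ℕ) :
    ω (n + 1) = ω' 0 := by
  have h1 := baryCode_eq_of_code_eq h (ω' 0)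
  rw [baryCode_zero_add, baryCode_zero_add _ ω', if_neg h0, if_pos rfl] at h1
  -- In the coordinate of the letter `ω' 0` the sequence `ω'` has at least 1/2. The first letter of
  -- `ω` contributes nothing, so the tail of `ω` must have the full coordinate 1.
  refine eq_of_one_le_baryCode (ω := fun n => ω (n + 1)) ?_ n
  linarith [baryCode_nonneg (ω' 0) (fun n => ω' (n + 1))]

lemma contr_injective (i : Fin 3) : Function.Injective (contr i) := by
  intro x y h
  simp only [contr_eq, add_left_inj] at h
  exact smul_right_injective _ (by norm_num : (1 / 2 : ℝ) ≠ 0) h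

lemma cell_injective (w : List (Fin 3)) : Function.Injective (cell w) := by
  induction w with
  | nil => exact fun _ _ h => h
  | cons i w ih => exact (contr_injective i).comp ih

/-- Distinct sequences that code the same point are `s a b b b …` and `s b a a a …`. -/
lemma exists_of_code_eq {ω ω' : ℕ → Fin 3} (h : code ω = code ω') (hne : ω ≠ ω') :
    ∃ N, (∀ k < N, ω k = ω' k) ∧ ω N ≠ ω' N ∧ (∀ k > N, ω k = ω' N) ∧ ∀ k > N, ω' k = ω N := by
  classical
  have hex : ∃ n, ω n ≠ ω' n := Function.ne_iff.1 hne
  refine ⟨Nat.find hex, fun k hk => not_not.1 (Nat.find_min hex hk), Nat.find_spec hex, ?_⟩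
  set N := Nat.find hex
  have hlt : ∀ k < N, ω k = ω' k := fun k hk => not_not.1 (Nat.find_min hex hk)
  have hN : ω N ≠ ω' N := Nat.find_spec hex
  have h' : code (fun k => ω (N + k)) = code (fun k => ω' (N + k)) := by
    apply cell_injective (initialWord ω N)
    rw [← code_eq_cell, initialWord_eq_iff.2 hlt, ← code_eq_cell, h]
  constructor
  · intro k hk
    obtain ⟨d, rfl⟩ := Nat.exists_eq_add_of_lt hk
    exact code_eq_of_ne_zero h' hN d
  · intro k hk
    obtain ⟨d, rfl⟩ := Nat.exists_eq_add_of_lt hk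
    exact code_eq_of_ne_zero h'.symm hN.symm d

/-- Functions of the code that do not distinguish the two codes of a junction point descend to
continuous functions on the gasket. -/
lemma exists_continuousOn_of_code {U : (ℕ → Fin 3) → ℝ} (hU : Continuous U)
    (h : ∀ ω ω', ∀ N, (∀ k < N, ω k = ω' k) → ω N ≠ ω' N → (∀ k > N, ω k = ω' N) →
      (∀ k > N, ω' k = ω N) → U ω = U ω') :
    ∃ u : Plane → ℝ, ContinuousOn u SG ∧ ∀ ω, u (code ω) = U ω := by
  have hfac : Function.FactorsThrough U code := by
    intro ω ω' he
    by_cases hne : ω = ω'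
    · rw [hne]
    · obtain ⟨N, h1, h2, h3, h4⟩ := exists_of_code_eq he hne
      exact h ω ω' N h1 h2 h3 h4
  refine ⟨Function.extend code U 0, ?_, fun ω => hfac.extend_apply _ _⟩
  -- A continuous surjection from a compact space onto a Hausdorff space is closed, hence a quotient
  -- map.
  have hq : IsQuotientMap (Set.rangeFactorization code) :=
    IsClosedMap.isQuotientMap
      (continuous_code.subtype_mk _).isClosedMap (continuous_code.subtype_mk _)
      Set.rangeFactorization_surjective
  rw [continuousOn_iff_continuous_domRestrict]
  refine hq.continuous_iff.2 ?_
  convert hU using 1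
  ext1 ω
  exact hfac.extend_apply _ _

/-! ### The self-similar measure -/

/-- The law of a sequence of independent uniform letters. -/
noncomputable abbrev codeMeasure : Measure (ℕ → Fin 3) :=
  Measure.infinitePi fun _ : ℕ => letterMeasure

lemma measurable_code : Measurable code := continuous_code.measurable

instance : IsProbabilityMeasure mu := Measure.isProbabilityMeasure_map measurable_code.aemeasurable

lemma measurableSet_SG : MeasurableSet SG := isCompact_SG.isClosed.measurableSet

lemma ae_mem_SG : ∀ᵐ x ∂mu, x ∈ SG := by
  refine (ae_map_iff measurable_code.aemeasurable (p := fun x => x ∈ SG) measurableSet_SG).2 ?_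
  exact Eventually.of_forall code_mem_SG

lemma mu_restrict_SG : mu.restrict SG = mu := Measure.restrict_eq_self_of_ae_mem ae_mem_SG

lemma aestronglyMeasurable_of_continuousOn {u : Plane → ℝ} (hu : ContinuousOn u SG) :
    AEStronglyMeasurable u mu := by
  rw [← mu_restrict_SG]
  exact hu.aestronglyMeasurable measurableSet_SG

lemma exists_bound_of_continuousOn {u : Plane → ℝ} (hu : ContinuousOn u SG) :
    ∃ B, ∀ x ∈ SG, ‖u x‖ ≤ B := isCompact_SG.exists_bound_of_continuousOn hu

lemma memLp_of_continuousOn {u : Plane → ℝ} (hu : ContinuousOn u SG) (p : ℝ≥0∞) :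
    MemLp u p mu := by
  obtain ⟨B, hB⟩ := exists_bound_of_continuousOn hu
  exact MemLp.of_bound (aestronglyMeasurable_of_continuousOn hu) B (ae_mem_SG.mono hB)

lemma integrable_of_continuousOn {u : Plane → ℝ} (hu : ContinuousOn u SG) :
    Integrable u mu := memLp_one_iff_integrable.1 (memLp_of_continuousOn hu 1)

lemma integral_mu {u : Plane → ℝ} (hu : ContinuousOn u SG) :
    ∫ x, u x ∂mu = ∫ ω, u (code ω) ∂codeMeasure :=
  integral_map measurable_code.aemeasurable (aestronglyMeasurable_of_continuousOn hu)

/-- The sequences that start with the word of a given sequence. -/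
def cylinder (ω : ℕ → Fin 3) (n : ℕ) : Set (ℕ → Fin 3) := {η | ∀ k < n, η k = ω k}

lemma cylinder_eq_pi (ω : ℕ → Fin 3) (n : ℕ) :
    cylinder ω n = Set.pi (Finset.range n : Set ℕ) fun k => {ω k} := by
  ext η
  simp [cylinder, Set.mem_pi]

lemma measurableSet_cylinder (ω : ℕ → Fin 3) (n : ℕ) : MeasurableSet (cylinder ω n) := by
  rw [cylinder_eq_pi]
  exact MeasurableSet.pi (Finset.countable_toSet _) fun k _ => measurableSet_singleton _

lemma codeMeasure_cylinder (ω : ℕ → Fin 3) (n : ℕ) : codeMeasure (cylinder ω n) = 3⁻¹ ^ n := by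
  rw [cylinder_eq_pi, Measure.infinitePi_pi _ (fun k _ => measurableSet_singleton _)]
  simp

lemma codeMeasure_singleton (ω : ℕ → Fin 3) : codeMeasure {ω} = 0 := by
  have h : Tendsto (fun n : ℕ => (3⁻¹ : ℝ≥0∞) ^ n) atTop (𝓝 0) :=
    ENNReal.tendsto_pow_atTop_nhds_zero_of_lt_one (by simp [ENNReal.inv_lt_one])
  refine le_antisymm (ge_of_tendsto' h fun n => ?_) zero_le
  rw [← codeMeasure_cylinder ω n]
  exact measure_mono (by rintro _ rfl k _; rfl)

/-- Only eventually constant sequences code junction points. They are countable in number, so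
overlaps of cells do not affect measures. -/
lemma codeMeasure_range_constTail :
    codeMeasure (Set.range fun p : List (Fin 3) × Fin 3 => constTail p.1 p.2) = 0 := by
  rw [← Set.iUnion_singleton_eq_range, measure_iUnion_null_iff]
  exact fun p => codeMeasure_singleton _

lemma integral_initialWord (m : ℕ) (f : List (Fin 3) → ℝ) :
    ∫ ω, f (initialWord ω m) ∂codeMeasure = (1 / 3) ^ m * ∑ w : Fin m → Fin 3, f (List.ofFn w) := by
  have hmeas : Measurable fun (ω : ℕ → Fin 3) (k : Fin m) => ω k := by fun_prop
  have : ∫ ω, f (initialWord ω m) ∂codeMeasure =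
      ∫ w, f (List.ofFn w) ∂(codeMeasure.map fun (ω : ℕ → Fin 3) (k : Fin m) => ω k) := by
    rw [integral_map hmeas.aemeasurable (measurable_of_finite _).aestronglyMeasurable]
    rfl
  have _ := Measure.isProbabilityMeasure_map (μ := codeMeasure) hmeas.aemeasurable
  rw [this, integral_fintype .of_finite, Finset.mul_sum]
  refine Finset.sum_congr rfl fun w _ => ?_
  rw [map_measureReal_apply hmeas (measurableSet_singleton w), smul_eq_mul]
  congr 1
  have hc : (fun (ω : ℕ → Fin 3) (k : Fin m) => ω k) ⁻¹' {w} =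
      cylinder (constTail (List.ofFn w) 0) m := by
    ext ω
    simp only [Set.mem_preimage, Set.mem_singleton_iff, cylinder, Set.mem_ofPred_eq]
    constructor
    · rintro rfl k hk
      simp [constTail, hk]
    · intro h
      ext1 k
      rw [h k k.2]
      simp [constTail]
  rw [hc, measureReal_def, codeMeasure_cylinder]
  simp

/-- The mean over the corners with label `i` of the cells of level `m` tends to the integral. -/
lemma tendsto_mean_corner {u : Plane → ℝ} (hu : ContinuousOn u SG) (i : Fin 3) :
    Tendsto (fun m : ℕ => (1 / 3 : ℝ) ^ m * ∑ w : Fin m → Fin 3, u (cell (List.ofFn w) (vertex i)))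
      atTop (𝓝 (∫ x, u x ∂mu)) := by
  obtain ⟨B, hB⟩ := exists_bound_of_continuousOn hu
  simp_rw [← integral_initialWord _ fun w => u (cell w (vertex i))]
  rw [integral_mu hu]
  refine tendsto_integral_of_dominated_convergence (fun _ => B) (fun m => ?_)
    (integrable_const B) (fun m => ?_) ?_
  · have h : Measurable fun ω : ℕ → Fin 3 => fun k : Fin m => ω k := by fun_prop
    exact ((measurable_of_finite fun w : Fin m → Fin 3 =>
      u (cell (List.ofFn w) (vertex i))).comp h).aestronglyMeasurable
  · exact Eventually.of_forall fun ω => hB _ (cell_vertex_mem_SG _ i)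
  · refine Eventually.of_forall fun ω => ?_
    exact (hu (code ω) (code_mem_SG ω)).tendsto.comp (tendsto_cell_initialWord ω i)

/-- A sequence whose code lies in a cell starts with the word of the cell, or is eventually
constant. -/
lemma initialWord_eq_or_mem_range {ω : ℕ → Fin 3} {w : List (Fin 3)} (h : code ω ∈ cell w '' SG) :
    initialWord ω w.length = w ∨
      ω ∈ Set.range fun p : List (Fin 3) × Fin 3 => constTail p.1 p.2 := by
  obtain ⟨_, ⟨η, rfl⟩, hη⟩ := h
  -- The code of the given point that starts with `w`: the word `w` followed by `η`.
  set ω' : ℕ → Fin 3 := fun n => if h : n < w.length then w[n] else η (n - w.length) with hω'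
  have hw : initialWord ω' w.length = w := by
    apply List.ext_getElem
    · simp
    · intro n _ _
      simp [initialWord, hω']
  have hcode : code ω = code ω' := by
    rw [← hη, code_eq_cell w.length ω', hw]
    congr 2
    ext1 k
    simp [hω']
  by_cases hne : ω = ω'
  · left
    rw [hne, hw]
  · right
    obtain ⟨N, -, -, h3, -⟩ := exists_of_code_eq hcode hne
    refine ⟨(initialWord ω (N + 1), ω' N), ?_⟩
    ext1 k
    by_cases hk : k < N + 1
    · exact constTail_initialWord_of_lt ω hk _
    · rw [h3 k (by omega)]
      exact constTail_of_le (by simp; omega) _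

lemma isCompact_cell_SG (w : List (Fin 3)) : IsCompact (cell w '' SG) := by
  refine isCompact_SG.image ?_
  induction w with
  | nil => exact continuous_id
  | cons i w ih => exact (continuous_contr i).comp ih

lemma mu_real_cell_le (w : List (Fin 3)) : mu.real (cell w '' SG) ≤ (1 / 3) ^ w.length := by
  have h : mu (cell w '' SG) ≤ 3⁻¹ ^ w.length := by
    rw [mu, Measure.map_apply measurable_code (isCompact_cell_SG w).isClosed.measurableSet,
      ← codeMeasure_cylinder (constTail w 0)]
    calc codeMeasure (code ⁻¹' (cell w '' SG))
        ≤ codeMeasure (cylinder (constTail w 0) w.length ∪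
            Set.range fun p : List (Fin 3) × Fin 3 => constTail p.1 p.2) := by
          refine measure_mono fun ω hω => (initialWord_eq_or_mem_range hω).imp_left fun h => ?_
          refine initialWord_eq_iff.1 ?_
          rw [h, initialWord_constTail]
      _ ≤ _ := measure_union_le _ _
      _ = _ := by rw [codeMeasure_range_constTail, add_zero]
  calc mu.real (cell w '' SG) ≤ ((3⁻¹ : ℝ≥0∞) ^ w.length).toReal :=
        ENNReal.toReal_mono (by simp) h
    _ = _ := by simp

/-! ### The energy and its bilinear form -/

/-- The bilinear form of the graph energy. -/
noncomputable def graphForm (m : ℕ) (u v : Plane → ℝ) : ℝ :=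
  ∑ w : Fin m → Fin 3, (1 / 2 : ℝ) * ∑ i : Fin 3, ∑ k : Fin 3,
    (u (cell (List.ofFn w) (vertex i)) - u (cell (List.ofFn w) (vertex k))) *
      (v (cell (List.ofFn w) (vertex i)) - v (cell (List.ofFn w) (vertex k)))

lemma graphForm_self (m : ℕ) (u : Plane → ℝ) : graphForm m u u = graphEnergy m u := by
  simp only [graphForm, graphEnergy, sq]

lemma graphEnergy_nonneg (m : ℕ) (u : Plane → ℝ) : 0 ≤ graphEnergy m u := by
  unfold graphEnergy
  positivity

lemma graphEnergy_polarization (m : ℕ) (u v : Plane → ℝ) :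
    graphForm m u v = (graphEnergy m (u + v) - graphEnergy m (u - v)) / 4 := by
  unfold graphForm graphEnergy
  rw [← Finset.sum_sub_distrib, Finset.sum_div]
  refine Finset.sum_congr rfl fun w _ => ?_
  rw [← mul_sub, ← Finset.sum_sub_distrib, mul_div_assoc, Finset.sum_div]
  congr 1
  refine Finset.sum_congr rfl fun i _ => ?_
  rw [← Finset.sum_sub_distrib, Finset.sum_div]
  refine Finset.sum_congr rfl fun k _ => ?_
  simp only [Pi.add_apply, Pi.sub_apply]
  ring

lemma graphEnergy_parallelogram (m : ℕ) (u v : Plane → ℝ) :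
    graphEnergy m (u + v) + graphEnergy m (u - v) = 2 * (graphEnergy m u + graphEnergy m v) := by
  unfold graphEnergy
  simp only [← Finset.sum_add_distrib, Finset.mul_sum, Pi.add_apply, Pi.sub_apply]
  refine Finset.sum_congr rfl fun w _ => Finset.sum_congr rfl fun i _ =>
    Finset.sum_congr rfl fun k _ => ?_
  ring

lemma graphForm_smul_left (m : ℕ) (c : ℝ) (u v : Plane → ℝ) :
    graphForm m (c • u) v = c * graphForm m u v := by
  unfold graphForm
  simp only [Finset.mul_sum, Pi.smul_apply, smul_eq_mul]
  refine Finset.sum_congr rfl fun w _ => Finset.sum_congr rfl fun i _ =>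
    Finset.sum_congr rfl fun k _ => ?_
  ring

lemma graphForm_comm (m : ℕ) (u v : Plane → ℝ) : graphForm m u v = graphForm m v u := by
  simp only [graphForm, mul_comm]

lemma graphEnergy_smul (m : ℕ) (c : ℝ) (u : Plane → ℝ) :
    graphEnergy m (c • u) = c ^ 2 * graphEnergy m u := by
  rw [← graphForm_self, graphForm_smul_left, graphForm_comm, graphForm_smul_left, graphForm_self]
  ring

lemma sum_word_succ {M : Type*} [AddCommMonoid M] (m : ℕ) (f : List (Fin 3) → M) :
    ∑ w : Fin (m + 1) → Fin 3, f (List.ofFn w) =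
      ∑ w : Fin m → Fin 3, ∑ l : Fin 3, f (List.ofFn w ++ [l]) := by
  rw [← (Fin.snocEquiv fun _ : Fin (m + 1) => Fin 3).sum_comp, Fintype.sum_prod_type,
    Finset.sum_comm]
  refine Finset.sum_congr rfl fun w _ => Finset.sum_congr rfl fun l _ => ?_
  congr 1
  rw [List.ofFn_succ', List.concat_eq_append]
  congr 2
  · ext1 k
    simp [Fin.snocEquiv]
  · simp [Fin.snocEquiv]

/-- Subdividing a cell multiplies its energy at least by `3 / 5`. -/
lemma cell_energy_le (X : Fin 3 → Fin 3 → ℝ) (hX : ∀ i k, X i k = X k i) :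
    (1 / 2 : ℝ) * ∑ i : Fin 3, ∑ k : Fin 3, (X i i - X k k) ^ 2 ≤
      5 / 3 * ∑ l : Fin 3, (1 / 2 : ℝ) * ∑ i : Fin 3, ∑ k : Fin 3, (X l i - X l k) ^ 2 := by
  simp only [Fin.sum_univ_three]
  rw [hX 1 0, hX 2 0, hX 2 1]
  -- The deviations of the midpoint values from the harmonic extension, which minimizes the energy
  -- of the subdivided cell. The difference of the two sides is a nonnegative quadratic form in
  -- them.
  set a := X 0 1 - (2 * X 0 0 + 2 * X 1 1 + X 2 2) / 5 with ha
  set b := X 0 2 - (2 * X 0 0 + 2 * X 2 2 + X 1 1) / 5 with hb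
  set c := X 1 2 - (2 * X 1 1 + 2 * X 2 2 + X 0 0) / 5 with hc
  have ha' : X 0 1 = a + (2 * X 0 0 + 2 * X 1 1 + X 2 2) / 5 := by rw [ha]; ring
  have hb' : X 0 2 = b + (2 * X 0 0 + 2 * X 2 2 + X 1 1) / 5 := by rw [hb]; ring
  have hc' : X 1 2 = c + (2 * X 1 1 + 2 * X 2 2 + X 0 0) / 5 := by rw [hc]; ring
  clear_value a b c
  rw [ha', hb', hc']
  linarith [sq_nonneg a, sq_nonneg b, sq_nonneg c, sq_nonneg (a - b), sq_nonneg (a - c),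
    sq_nonneg (b - c)]

lemma graphEnergy_le_succ (m : ℕ) (u : Plane → ℝ) :
    graphEnergy m u ≤ 5 / 3 * graphEnergy (m + 1) u := by
  unfold graphEnergy
  rw [sum_word_succ m fun w => (1 / 2 : ℝ) * ∑ i : Fin 3, ∑ k : Fin 3,
    (u (cell w (vertex i)) - u (cell w (vertex k))) ^ 2, Finset.mul_sum]
  refine Finset.sum_le_sum fun w _ => ?_
  have := cell_energy_le (fun i k => u (cell (List.ofFn w) (contr i (vertex k))))
    fun i k => by rw [contr_vertex_comm]
  simpa only [cell_concat, contr_vertex] using this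

lemma monotone_graphEnergy (u : Plane → ℝ) :
    Monotone fun m : ℕ => (5 / 3 : ℝ) ^ m * graphEnergy m u := by
  refine monotone_nat_of_le_succ fun m => ?_
  rw [pow_succ, mul_assoc]
  exact mul_le_mul_of_nonneg_left (graphEnergy_le_succ m u) (by positivity)

lemma graphEnergy_le_energy {u : Plane → ℝ} (hu : energy u ≠ ⊤) (m : ℕ) :
    (5 / 3 : ℝ) ^ m * graphEnergy m u ≤ (energy u).toReal := by
  rw [← ENNReal.ofReal_le_iff_le_toReal hu]
  exact le_iSup (fun m : ℕ => ENNReal.ofReal ((5 / 3 : ℝ) ^ m * graphEnergy m u)) m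

lemma energy_ne_top_of_le {u : Plane → ℝ} {B : ℝ}
    (h : ∀ m : ℕ, (5 / 3 : ℝ) ^ m * graphEnergy m u ≤ B) : energy u ≠ ⊤ :=
  ne_top_of_le_ne_top ENNReal.ofReal_ne_top
    (iSup_le fun m => ENNReal.ofReal_le_ofReal (h m))

lemma tendsto_graphEnergy {u : Plane → ℝ} (hu : energy u ≠ ⊤) :
    Tendsto (fun m : ℕ => (5 / 3 : ℝ) ^ m * graphEnergy m u) atTop (𝓝 (energy u).toReal) := by
  have h := tendsto_atTop_iSup (f := fun m : ℕ => ENNReal.ofReal ((5 / 3 : ℝ) ^ m * graphEnergy m u))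
    fun _ _ h => ENNReal.ofReal_le_ofReal (monotone_graphEnergy u h)
  refine ((ENNReal.tendsto_toReal hu).comp h).congr fun m => ?_
  exact ENNReal.toReal_ofReal (mul_nonneg (by positivity) (graphEnergy_nonneg m u))

/-- The parallelogram identity bounds both energies at once on every level. Polarization therefore
takes place among finite numbers. -/
lemma energy_add_sub_ne_top {u v : Plane → ℝ} (hu : energy u ≠ ⊤) (hv : energy v ≠ ⊤) :
    energy (u + v) ≠ ⊤ ∧ energy (u - v) ≠ ⊤ := by
  have key : ∀ m : ℕ, (5 / 3 : ℝ) ^ m * graphEnergy m (u + v) +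
      (5 / 3 : ℝ) ^ m * graphEnergy m (u - v) ≤ 2 * ((energy u).toReal + (energy v).toReal) := by
    intro m
    have := graphEnergy_parallelogram m u v
    rw [← mul_add, this]
    linarith [graphEnergy_le_energy hu m, graphEnergy_le_energy hv m]
  have nn : ∀ (m : ℕ) (f : Plane → ℝ), 0 ≤ (5 / 3 : ℝ) ^ m * graphEnergy m f := fun m f =>
    mul_nonneg (by positivity) (graphEnergy_nonneg m f)
  exact ⟨energy_ne_top_of_le fun m => (le_add_of_nonneg_right (nn m _)).trans (key m),
    energy_ne_top_of_le fun m => (le_add_of_nonneg_left (nn m _)).trans (key m)⟩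

lemma tendsto_graphForm {u v : Plane → ℝ} (hu : u ∈ neumannDomain) (hv : v ∈ neumannDomain) :
    Tendsto (fun m : ℕ => (5 / 3 : ℝ) ^ m * graphForm m u v) atTop (𝓝 (energyForm u v)) := by
  obtain ⟨h1, h2⟩ := energy_add_sub_ne_top hu.2 hv.2
  refine (((tendsto_graphEnergy h1).sub (tendsto_graphEnergy h2)).div_const 4).congr fun m => ?_
  rw [graphEnergy_polarization]
  ring

lemma smul_mem_neumannDomain {u : Plane → ℝ} (hu : u ∈ neumannDomain) (c : ℝ) :
    c • u ∈ neumannDomain := by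
  refine ⟨hu.1.const_smul c, energy_ne_top_of_le (B := c ^ 2 * (energy u).toReal) fun m => ?_⟩
  rw [graphEnergy_smul, mul_left_comm]
  exact mul_le_mul_of_nonneg_left (graphEnergy_le_energy hu.2 m) (sq_nonneg c)

lemma smul_mem_dirichletDomain {u : Plane → ℝ} (hu : u ∈ dirichletDomain) (c : ℝ) :
    c • u ∈ dirichletDomain :=
  ⟨smul_mem_neumannDomain hu.1 c, fun i => by simp [hu.2 i]⟩

lemma energyForm_self {u : Plane → ℝ} (hu : u ∈ neumannDomain) :
    energyForm u u = (energy u).toReal := by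
  refine tendsto_nhds_unique (tendsto_graphForm hu hu) ?_
  simpa only [graphForm_self] using tendsto_graphEnergy hu.2

lemma energyForm_comm {u v : Plane → ℝ} (hu : u ∈ neumannDomain) (hv : v ∈ neumannDomain) :
    energyForm u v = energyForm v u := by
  refine tendsto_nhds_unique (tendsto_graphForm hu hv) ?_
  simpa only [graphForm_comm] using tendsto_graphForm hv hu

lemma energyForm_smul_left {u v : Plane → ℝ} (hu : u ∈ neumannDomain) (hv : v ∈ neumannDomain)
    (c : ℝ) : energyForm (c • u) v = c * energyForm u v := by
  refine tendsto_nhds_unique (tendsto_graphForm (smul_mem_neumannDomain hu c) hv) ?_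
  refine ((tendsto_graphForm hu hv).const_mul c).congr fun m => ?_
  rw [graphForm_smul_left]
  ring

lemma SolvesEigenEq.smul {D : Set (Plane → ℝ)} (hD : D ⊆ neumannDomain)
    (hsmul : ∀ u ∈ D, ∀ c : ℝ, c • u ∈ D) {lam : ℝ} {u : Plane → ℝ} (hu : SolvesEigenEq D lam u)
    (c : ℝ) : SolvesEigenEq D lam (c • u) := by
  refine ⟨hsmul u hu.1 c, fun v hv => ?_⟩
  rw [energyForm_smul_left (hD hu.1) (hD hv), hu.2 v hv]
  simp only [Pi.smul_apply, smul_eq_mul, mul_assoc]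
  rw [integral_const_mul]
  ring

/-! ### Oscillation and supremum bounds from the energy -/

lemma fin_three_cases : ∀ i : Fin 3, i = 0 ∨ i = 1 ∨ i = 2 := by decide

lemma sq_sub_le_cell_energy (x : Fin 3 → ℝ) (i k : Fin 3) :
    (x i - x k) ^ 2 ≤ (1 / 2 : ℝ) * ∑ i : Fin 3, ∑ k : Fin 3, (x i - x k) ^ 2 := by
  simp only [Fin.sum_univ_three]
  rcases fin_three_cases i with rfl | rfl | rfl <;>
    rcases fin_three_cases k with rfl | rfl | rfl <;>
    linarith [sq_nonneg (x 0 - x 1), sq_nonneg (x 0 - x 2), sq_nonneg (x 1 - x 2)]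

lemma sq_sub_corner_le {u : Plane → ℝ} (hu : energy u ≠ ⊤) (w : List (Fin 3)) (i k : Fin 3) :
    (u (cell w (vertex i)) - u (cell w (vertex k))) ^ 2 ≤
      (3 / 5) ^ w.length * (energy u).toReal := by
  have h1 : (u (cell w (vertex i)) - u (cell w (vertex k))) ^ 2 ≤ graphEnergy w.length u := by
    have h2 := Finset.single_le_sum (f := fun w : Fin w.length → Fin 3 =>
      (1 / 2 : ℝ) * ∑ i : Fin 3, ∑ k : Fin 3,
        (u (cell (List.ofFn w) (vertex i)) - u (cell (List.ofFn w) (vertex k))) ^ 2)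
      (fun w _ => by positivity) (Finset.mem_univ w.get)
    refine le_trans ?_ h2
    simpa only [List.ofFn_get] using sq_sub_le_cell_energy (fun i => u (cell w (vertex i))) i k
  have h2 := graphEnergy_le_energy hu w.length
  calc _ ≤ graphEnergy w.length u := h1
    _ = (3 / 5) ^ w.length * ((5 / 3 : ℝ) ^ w.length * graphEnergy w.length u) := by
      rw [← mul_assoc, ← mul_pow]; norm_num
    _ ≤ _ := by gcongr

lemma abs_sub_corner_le {u : Plane → ℝ} (hu : energy u ≠ ⊤) (w : List (Fin 3)) (i k : Fin 3) :
    |u (cell w (vertex i)) - u (cell w (vertex k))| ≤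
      √(3 / 5) ^ w.length * √(energy u).toReal := by
  refine abs_le_of_sq_le_sq ?_ (by positivity)
  rw [mul_pow, Real.sq_sqrt ENNReal.toReal_nonneg, ← pow_mul, mul_comm w.length 2, pow_mul,
    Real.sq_sqrt (by norm_num)]
  exact sq_sub_corner_le hu w i k

lemma sqrt_three_fifths_lt_one : √(3 / 5 : ℝ) < 1 := by
  rw [Real.sqrt_lt' one_pos]
  norm_num

/-- The oscillation estimate on cells for functions of finite energy. -/
lemma abs_sub_code_le {u : Plane → ℝ} (hu : u ∈ neumannDomain) (ω : ℕ → Fin 3) (m : ℕ)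
    (i : Fin 3) :
    |u (cell (initialWord ω m) (vertex i)) - u (code ω)| ≤
      2 / (1 - √(3 / 5)) * (√(3 / 5) ^ m * √(energy u).toReal) := by
  have h := dist_le_of_le_geometric_of_tendsto₀ (√(3 / 5 : ℝ))
    (2 * (√(3 / 5) ^ m * √(energy u).toReal)) sqrt_three_fifths_lt_one
    (f := fun n => u (cell (initialWord ω (m + n)) (vertex i))) (a := u (code ω)) (fun n => ?_) ?_
  · rw [Real.dist_eq, mul_div_right_comm] at h
    exact h
  · have h1 := abs_sub_corner_le hu.2 (initialWord ω (m + n)) i (ω (m + n))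
    have h2 := abs_sub_corner_le hu.2 (initialWord ω (m + n + 1)) (ω (m + n)) i
    rw [length_initialWord] at h1 h2
    -- The corner labelled `ω (m + n)` is common to the cell and its subcell along `ω`, so the move
    -- from corner `i` to corner `i` of the next cell passes through it.
    have h3 : cell (initialWord ω (m + n + 1)) (vertex (ω (m + n))) =
        cell (initialWord ω (m + n)) (vertex (ω (m + n))) := by
      rw [initialWord_succ, cell_concat, contr_vertex]
    rw [h3] at h2
    have h4 : √(3 / 5) ^ (m + n + 1) * √(energy u).toReal ≤
        √(3 / 5) ^ (m + n) * √(energy u).toReal :=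
      mul_le_mul_of_nonneg_right (pow_le_pow_of_le_one (Real.sqrt_nonneg _)
        sqrt_three_fifths_lt_one.le (Nat.le_succ _)) (Real.sqrt_nonneg _)
    rw [Real.dist_eq]
    calc _ ≤ _ := abs_sub_le _ (u (cell (initialWord ω (m + n)) (vertex (ω (m + n))))) _
      _ ≤ 2 * (√(3 / 5) ^ (m + n) * √(energy u).toReal) := by
        rw [show m + (n + 1) = m + n + 1 from rfl]
        linarith
      _ = _ := by rw [pow_add]; ring
  · have h1 := (hu.1 (code ω) (code_mem_SG ω)).tendsto.comp (tendsto_cell_initialWord ω i)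
    exact h1.comp (tendsto_add_atTop_nat m |>.congr fun n => add_comm n m)

/-- A local Sobolev inequality: the supremum is controlled by the `L²` norm and the energy. -/
lemma exists_sq_le :
    ∃ A : ℝ, 0 < A ∧ ∀ u ∈ neumannDomain, ∀ m : ℕ, ∀ x ∈ SG,
      u x ^ 2 ≤ 4 * (3 ^ m * ∫ y, u y ^ 2 ∂mu) + A * ((3 / 5) ^ m * (energy u).toReal) := by
  have hpos : 0 < 2 / (1 - √(3 / 5 : ℝ)) := div_pos two_pos (sub_pos.2 sqrt_three_fifths_lt_one)
  refine ⟨6 * (2 / (1 - √(3 / 5))) ^ 2, by positivity, ?_⟩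
  rintro u hu m _ ⟨ω, rfl⟩
  set K := 2 / (1 - √(3 / 5)) * (√(3 / 5) ^ m * √(energy u).toReal) with hK
  set a := u (cell (initialWord ω m) (vertex 0)) with ha
  have hK2 : K ^ 2 = (2 / (1 - √(3 / 5))) ^ 2 * ((3 / 5) ^ m * (energy u).toReal) := by
    rw [hK, mul_pow, mul_pow _ (√(energy u).toReal), Real.sq_sqrt ENNReal.toReal_nonneg, ← pow_mul,
      mul_comm m 2, pow_mul, Real.sq_sqrt (by norm_num)]
  have hbound : ∀ η ∈ cylinder ω m, (a - u (code η)) ^ 2 ≤ K ^ 2 := by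
    intro η hη
    have h := abs_sub_code_le hu η m 0
    rw [initialWord_eq_iff.2 hη] at h
    exact sq_le_sq' (abs_le.1 h).1 (abs_le.1 h).2
  have hsq : ContinuousOn (fun x => u x ^ 2) SG := hu.1.pow 2
  have hint : Integrable (fun η => u (code η) ^ 2) codeMeasure :=
    (integrable_of_continuousOn hsq).comp_measurable measurable_code
  -- On the cylinder a² ≤ 2 u² + 2 K²; integrating and multiplying by 3^m bounds a². With u² ≤ 2 a²
  -- + 2 K² this makes the factors 4 and 6.
  have h1 : ∫ η in cylinder ω m, a ^ 2 ∂codeMeasure ≤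
      ∫ η in cylinder ω m, (2 * u (code η) ^ 2 + 2 * K ^ 2) ∂codeMeasure := by
    refine setIntegral_mono_on (integrable_const _).integrableOn
      ((hint.const_mul 2).add (integrable_const _)).integrableOn (measurableSet_cylinder ω m)
      fun η hη => ?_
    nlinarith [hbound η hη, sq_nonneg (a - 2 * u (code η))]
  have hcyl : codeMeasure.real (cylinder ω m) = (1 / 3) ^ m := by
    rw [measureReal_def, codeMeasure_cylinder]; simp
  rw [integral_add (hint.const_mul 2).integrableOn (integrable_const _).integrableOn,
    setIntegral_const, setIntegral_const, integral_const_mul, hcyl, smul_eq_mul, smul_eq_mul] at h1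
  have h2 : ∫ η in cylinder ω m, u (code η) ^ 2 ∂codeMeasure ≤ ∫ y, u y ^ 2 ∂mu := by
    rw [integral_mu hsq]
    exact setIntegral_le_integral hint (Eventually.of_forall fun η => sq_nonneg _)
  have h3 : a ^ 2 ≤ 2 * (3 ^ m * ∫ y, u y ^ 2 ∂mu) + 2 * K ^ 2 := by
    have h4 : (3 : ℝ) ^ m * (1 / 3) ^ m = 1 := by rw [← mul_pow]; norm_num
    have h5 : (0 : ℝ) < 3 ^ m := by positivity
    have h6 := mul_le_mul_of_nonneg_left (h1.trans (by gcongr :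
      _ ≤ 2 * ∫ y, u y ^ 2 ∂mu + (1 / 3) ^ m * (2 * K ^ 2))) h5.le
    rw [mul_add, ← mul_assoc, ← mul_assoc _ _ (2 * K ^ 2), h4] at h6
    linarith
  have h4 := hbound ω fun k _ => rfl
  have h5 : u (code ω) ^ 2 ≤ 2 * a ^ 2 + 2 * K ^ 2 := by
    nlinarith [sq_nonneg (2 * a - u (code ω))]
  rw [mul_assoc, ← hK2]
  linarith

/-! ### Spectral projections and Sobolev norms of eigenfunctions -/

lemma integral_mul_eq_zero_of_ne {D : Set (Plane → ℝ)} (hD : D ⊆ neumannDomain) {lam lam' : ℝ}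
    (hne : lam ≠ lam') {u v : Plane → ℝ} (hu : SolvesEigenEq D lam u)
    (hv : SolvesEigenEq D lam' v) : ∫ x, u x * v x ∂mu = 0 := by
  have h1 := hu.2 v hv.1
  have h2 := hv.2 u hu.1
  rw [energyForm_comm (hD hv.1) (hD hu.1), h1] at h2
  simp only [mul_comm (v _)] at h2
  by_contra h
  exact hne (mul_right_cancel₀ h h2)

lemma starProjection_of_ne {D : Set (Plane → ℝ)} (hD : D ⊆ neumannDomain) {lam lam' : ℝ}
    (hne : lam ≠ lam') {u : Plane → ℝ} (hu : SolvesEigenEq D lam u) (h : MemLp u 2 mu) :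
    (eigenspace D lam').starProjection (h.toLp u) = 0 := by
  refine Submodule.eq_starProjection_of_mem_orthogonal (Submodule.zero_mem _) ?_
  rw [sub_zero, eigenspace, Submodule.orthogonal_closure]
  suffices hs : Submodule.span ℝ {h.toLp u} ⟂
      Submodule.span ℝ {f : Lp ℝ 2 mu | ∃ u, SolvesEigenEq D lam' u ∧ f =ᵐ[mu] u} from
    hs (Submodule.mem_span_singleton_self _)
  rw [Submodule.isOrtho_span]
  rintro _ rfl g ⟨v, hv, hg⟩
  rw [L2.inner_def, ← integral_mul_eq_zero_of_ne hD hne hu hv]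
  refine integral_congr_ae ?_
  filter_upwards [h.coeFn_toLp, hg] with x h1 h2
  rw [h1, h2, mul_comm]
  rfl

lemma starProjection_self {D : Set (Plane → ℝ)} {lam : ℝ} {u : Plane → ℝ}
    (hu : SolvesEigenEq D lam u) (h : MemLp u 2 mu) :
    (eigenspace D lam).starProjection (h.toLp u) = h.toLp u :=
  Submodule.starProjection_eq_self_iff.2 <| Submodule.le_topologicalClosure _ <|
    Submodule.subset_span ⟨u, hu, h.coeFn_toLp⟩

/-- The Sobolev norm of a normalized eigenfunction. -/
lemma sobolevNorm_eq {D : Set (Plane → ℝ)} (hD : D ⊆ neumannDomain) {lam : ℝ} (hlam : 0 ≤ lam)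
    {u : Plane → ℝ} (hu : SolvesEigenEq D lam u) (hnorm : eLpNorm u 2 mu = 1) (s : ℝ) :
    sobolevNorm D s u = ENNReal.ofReal ((1 + lam) ^ (s / 2)) := by
  have h : MemLp u 2 mu := memLp_of_continuousOn (hD hu.1).1 2
  lift lam to ℝ≥0 using hlam
  rw [sobolevNorm, dif_pos h, tsum_eq_single lam]
  · rw [starProjection_self hu h, Lp.enorm_toLp, hnorm, one_pow, mul_one,
      ← ENNReal.rpow_mul, ← ENNReal.ofReal_rpow_of_pos (by positivity),
      ENNReal.ofReal_add zero_le_one lam.coe_nonneg, ENNReal.ofReal_one, ENNReal.ofReal_coe_nnreal,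
      mul_one_div]
  · intro lam' hne
    rw [starProjection_of_ne hD (fun h => hne (NNReal.eq h.symm)) hu h]
    simp

lemma spectralDim_pos : 0 < spectralDim :=
  div_pos (Real.log_pos (by norm_num)) (Real.log_pos (by norm_num))

lemma sobolevExp_nonneg {q : ℝ} (hq : 2 ≤ q) : 0 ≤ sobolevExp q := by
  unfold sobolevExp
  have h : 2 / q ≤ 1 := (div_le_one (by linarith)).2 hq
  have := spectralDim_pos
  exact mul_nonneg (by positivity) (by linarith)

lemma sobolevExp_le {q : ℝ} (hq : 2 ≤ q) : sobolevExp q ≤ spectralDim / 2 := by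
  unfold sobolevExp
  have h : 0 ≤ 2 / q := by positivity
  have := spectralDim_pos
  exact mul_le_of_le_one_right (by positivity) (by linarith)

/-- Here d_S = 2 log 3 / log 5, so 5^{σ_q/2} = 3^{1/2 - 1/q}: powers of the eigenvalue become powers
of the measure of a cell. -/
lemma rpow_sobolevExp {c : ℝ} (hc : 0 < c) (j : ℕ) (q : ℝ) :
    (c * 5 ^ j) ^ (sobolevExp q / 2) =
      c ^ (sobolevExp q / 2) * ((3 : ℝ) ^ j) ^ (1 / 2 - 1 / q) := by
  have h5 : (0 : ℝ) < Real.log 5 := Real.log_pos (by norm_num)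
  have h9 : Real.log 9 = 2 * Real.log 3 := by
    rw [show (9 : ℝ) = 3 ^ 2 by norm_num, Real.log_pow]; norm_num
  rw [Real.mul_rpow hc.le (by positivity)]
  congr 1
  rw [Real.rpow_def_of_pos (by positivity), Real.rpow_def_of_pos (by positivity), Real.log_pow,
    Real.log_pow, sobolevExp, spectralDim, h9]
  congr 1
  field_simp

/-- The Sobolev norms of localized eigenfunctions are comparable with a power of the eigenvalue. -/
lemma sobolevNorm_comparable {c : ℝ} (hc : 0 < c) {q : ℝ} (hq : 2 ≤ q) (j : ℕ)
    {D : Set (Plane → ℝ)} (hD : D ⊆ neumannDomain) {u : Plane → ℝ}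
    (hu : SolvesEigenEq D (c * 5 ^ j) u) (hnorm : eLpNorm u 2 mu = 1) :
    Comparable ((1 + 1 / c) ^ (spectralDim / 4)).toNNReal (sobolevNorm D (sobolevExp q) u)
      (ENNReal.ofReal ((c * 5 ^ j) ^ (sobolevExp q / 2))) := by
  have hlam : c ≤ c * 5 ^ j := le_mul_of_one_le_right hc.le (one_le_pow₀ (by norm_num))
  set lam := c * 5 ^ j with hl
  have hpos : 0 < lam := by positivity
  have hs := sobolevExp_nonneg hq
  have hs' := sobolevExp_le hq
  set s := sobolevExp q
  have h1 : 1 ≤ 1 + 1 / c := by simp; positivity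
  -- Raising the exponent to its bound d_S / 4 makes the constant independent of q.
  have hC : (1 + 1 / c) ^ (s / 2) ≤ (1 + 1 / c) ^ (spectralDim / 4) :=
    Real.rpow_le_rpow_of_exponent_le h1 (by linarith)
  have hC1 : 1 ≤ (1 + 1 / c) ^ (spectralDim / 4) :=
    Real.one_le_rpow h1 (by have := spectralDim_pos; positivity)
  have h2 : (1 + lam) ^ (s / 2) ≤ (1 + 1 / c) ^ (spectralDim / 4) * lam ^ (s / 2) := by
    calc (1 + lam) ^ (s / 2) ≤ ((1 + 1 / c) * lam) ^ (s / 2) := by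
          refine Real.rpow_le_rpow (by positivity) ?_ (by positivity)
          have : 1 ≤ 1 / c * lam := by
            rw [one_div_mul_eq_div]; exact (one_le_div hc).2 hlam
          linarith
      _ = (1 + 1 / c) ^ (s / 2) * lam ^ (s / 2) := Real.mul_rpow (by positivity) hpos.le
      _ ≤ _ := by gcongr
  rw [sobolevNorm_eq hD hpos.le hu hnorm, Comparable]
  change _ ≤ ENNReal.ofReal _ * _ ∧ _ ≤ ENNReal.ofReal _ * _
  rw [← ENNReal.ofReal_mul (by positivity), ← ENNReal.ofReal_mul (by positivity)]
  refine ⟨ENNReal.ofReal_le_ofReal h2, ENNReal.ofReal_le_ofReal ?_⟩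
  calc lam ^ (s / 2) ≤ (1 + lam) ^ (s / 2) :=
        Real.rpow_le_rpow hpos.le (by linarith) (by positivity)
    _ ≤ _ := le_mul_of_one_le_left (by positivity) hC1

/-! ### The L^q norms of localized eigenfunctions -/

lemma integral_sq_of_norm_eq {u : Plane → ℝ} (hu : ContinuousOn u SG)
    (hnorm : eLpNorm u 2 mu = 1) : ∫ x, u x ^ 2 ∂mu = 1 := by
  have h := (memLp_of_continuousOn hu 2).eLpNorm_eq_integral_rpow_norm (by simp) (by simp)
  rw [hnorm] at h
  have h2 : (0 : ℝ) ≤ ∫ x, u x ^ 2 ∂mu := integral_nonneg fun x => sq_nonneg _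
  simp only [ENNReal.toReal_ofNat, Real.rpow_ofNat, Real.norm_eq_abs, sq_abs] at h
  have h3 := (ENNReal.ofReal_eq_one.1 h.symm)
  rw [Real.rpow_inv_eq h2 zero_le_one two_ne_zero] at h3
  simpa using h3

lemma dirichletDomain_subset : dirichletDomain ⊆ neumannDomain := fun _ hu => hu.1

/-- The supremum bound for normalized eigenfunctions with eigenvalue `c 5^j`. -/
lemma exists_sq_le_of_eigen {c : ℝ} (hc : 0 < c) : ∃ B : ℝ, 0 < B ∧ ∀ j : ℕ, ∀ u : Plane → ℝ,
    SolvesEigenEq neumannDomain (c * 5 ^ j) u → eLpNorm u 2 mu = 1 →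
      ∀ x ∈ SG, u x ^ 2 ≤ B * 3 ^ j := by
  obtain ⟨A, hA, h⟩ := exists_sq_le
  refine ⟨4 + A * c, by positivity, fun j u hu hnorm x hx => ?_⟩
  -- The level m = j balances the two terms: 3^j from the L² norm, and (3/5)^j · c 5^j = c 3^j from
  -- the energy.
  have h1 := h u hu.1 j x hx
  have h2 := hu.2 u hu.1
  rw [energyForm_self hu.1] at h2
  simp only [← sq] at h2
  rw [h2, integral_sq_of_norm_eq hu.1.1 hnorm] at h1
  refine h1.trans_eq ?_
  have h3 : (3 / 5 : ℝ) ^ j * 5 ^ j = 3 ^ j := by rw [← mul_pow]; norm_num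
  rw [mul_one, mul_one, mul_left_comm _ c, h3]
  ring

/-- Interpolation: |u|^{2k} ≤ B^{k-1} |u|², and (k - 1)/(2k) is the stated exponent. -/
lemma eLpNorm_le_of_sq_le {u : Plane → ℝ} {B : ℝ} (hB : 0 ≤ B) (hle : ∀ x ∈ SG, u x ^ 2 ≤ B)
    (hnorm : eLpNorm u 2 mu = 1) {k : ℕ} (hk : 1 ≤ k) :
    eLpNorm u (2 * k : ℕ) mu ≤ ENNReal.ofReal (B ^ (1 / 2 - 1 / (2 * k : ℝ))) := by
  have hk0 : (k : ℝ) ≠ 0 := by positivity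
  have hL2 : ∫⁻ x, ‖u x‖ₑ ^ 2 ∂mu = 1 := by
    have h := hnorm
    rw [eLpNorm_eq_lintegral_rpow_enorm_toReal (by simp) (by simp)] at h
    simp only [ENNReal.toReal_ofNat, ENNReal.rpow_ofNat] at h
    have h' := congrArg (fun t : ℝ≥0∞ => t ^ (2 : ℝ)) h
    simpa only [← ENNReal.rpow_mul, one_div_mul_cancel (two_ne_zero (α := ℝ)), ENNReal.rpow_one,
      ENNReal.one_rpow] using h'
  have hq : ∫⁻ x, ‖u x‖ₑ ^ (2 * k) ∂mu ≤ ENNReal.ofReal (B ^ (k - 1)) := by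
    calc ∫⁻ x, ‖u x‖ₑ ^ (2 * k) ∂mu
        ≤ ∫⁻ x, ENNReal.ofReal (B ^ (k - 1)) * ‖u x‖ₑ ^ 2 ∂mu := by
          refine lintegral_mono_ae (ae_mem_SG.mono fun x hx => ?_)
          have h1 : ‖u x‖ₑ ^ 2 ≤ ENNReal.ofReal B := by
            rw [← ofReal_norm, ← ENNReal.ofReal_pow (norm_nonneg _), Real.norm_eq_abs, sq_abs]
            exact ENNReal.ofReal_le_ofReal (hle x hx)
          obtain ⟨d, rfl⟩ := Nat.exists_eq_add_of_le hk
          rw [show 1 + d - 1 = d by omega, add_comm 1 d, pow_mul, pow_succ, ENNReal.ofReal_pow hB]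
          gcongr
      _ = _ := by rw [lintegral_const_mul' _ _ ENNReal.ofReal_ne_top, hL2, mul_one]
  rw [eLpNorm_eq_lintegral_rpow_enorm_toReal (Nat.cast_ne_zero.2 (by omega))
    (ENNReal.natCast_ne_top _)]
  simp only [ENNReal.toReal_natCast, ENNReal.rpow_natCast]
  calc (∫⁻ x, ‖u x‖ₑ ^ (2 * k) ∂mu) ^ (1 / ((2 * k : ℕ) : ℝ))
      ≤ ENNReal.ofReal (B ^ (k - 1)) ^ (1 / ((2 * k : ℕ) : ℝ)) :=
        ENNReal.rpow_le_rpow hq (by positivity)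
    _ = _ := by
      rw [ENNReal.ofReal_rpow_of_nonneg (by positivity) (by positivity), ← Real.rpow_natCast,
        ← Real.rpow_mul hB, Nat.cast_sub hk]
      congr 2
      push_cast
      field_simp

/-- Hölder's inequality between L² and L^{2k} on the support, where all of the mass lies. -/
lemma one_le_eLpNorm_mul_support {u : Plane → ℝ} (hu : ContinuousOn u SG)
    (hnorm : eLpNorm u 2 mu = 1) {k : ℕ} (hk : 1 ≤ k) :
    1 ≤ eLpNorm u (2 * k : ℕ) mu * mu (support u) ^ (1 / 2 - 1 / (2 * k : ℝ)) := by
  have hms : MeasurableSet (support u) := isClosed_closure.measurableSet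
  have hae : (support u).indicator u =ᵐ[mu] u := by
    filter_upwards [ae_mem_SG] with x hx
    refine Set.indicator_apply_eq_self.2 fun h => ?_
    by_contra h0
    exact h (subset_closure ⟨hx, h0⟩)
  have h := eLpNorm_le_eLpNorm_mul_rpow_measure_univ (p := 2) (q := (2 * k : ℕ))
    (by exact_mod_cast (by omega : 2 ≤ 2 * k))
    (aestronglyMeasurable_of_continuousOn hu).restrict (μ := mu.restrict (support u))
  rw [← eLpNorm_indicator_eq_eLpNorm_restrict hms, ← eLpNorm_indicator_eq_eLpNorm_restrict hms,
    eLpNorm_congr_ae hae, eLpNorm_congr_ae hae, hnorm, Measure.restrict_apply_univ] at h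
  simpa using h

/-- The `L^q` norms of localized eigenfunctions. -/
lemma exists_eLpNorm_comparable {c : ℝ} (hc : 0 < c) {k : ℕ} (hk : 1 ≤ k) :
    ∃ C : ℝ≥0, ∀ j : ℕ, ∀ u : Plane → ℝ, IsLocalizedEigenfunction c j u →
      Comparable C (eLpNorm u (2 * k : ℕ) mu)
        (ENNReal.ofReal ((c * 5 ^ j) ^ (sobolevExp (2 * k) / 2))) := by
  obtain ⟨B, hB, h⟩ := exists_sq_le_of_eigen hc
  have hk1 : (1 : ℝ) ≤ k := by exact_mod_cast hk
  set e : ℝ := 1 / 2 - 1 / (2 * k : ℝ) with he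
  have he0 : 0 ≤ e := by
    rw [he, sub_nonneg]
    exact one_div_le_one_div_of_le two_pos (by linarith)
  set a : ℝ := c ^ (sobolevExp (2 * k) / 2) with ha
  have hapos : 0 < a := by positivity
  -- The first summand serves the upper bound, the second the lower one; 6 comes from μ(supp) ≤ 2 ·
  -- 3^{-j+1}.
  refine ⟨(B ^ e * a⁻¹ + a * 6 ^ e).toNNReal, fun j u hu => ?_⟩
  rw [rpow_sobolevExp hc, ← he, ← ha]
  set T : ℝ := (3 ^ j) ^ e with hT
  have hTpos : 0 < T := by positivity
  constructor
  · have h1 := eLpNorm_le_of_sq_le (by positivity) (h j u hu.neumann hu.norm_eq) hu.norm_eq hk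
    refine h1.trans ?_
    change _ ≤ ENNReal.ofReal _ * _
    rw [← ENNReal.ofReal_mul (by positivity)]
    refine ENNReal.ofReal_le_ofReal ?_
    rw [← he, Real.mul_rpow hB.le (by positivity), ← hT]
    calc B ^ e * T = B ^ e * a⁻¹ * (a * T) := by field_simp
      _ ≤ _ := by gcongr; exact le_add_of_nonneg_right (by positivity)
  · have h1 := one_le_eLpNorm_mul_support hu.neumann.1.1 hu.norm_eq hk
    have h2 : mu (support u) ≤ ENNReal.ofReal (6 * (3 ^ j)⁻¹) := by
      rw [← ofReal_measureReal]
      refine ENNReal.ofReal_le_ofReal ?_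
      have := hu.support_le
      rw [zpow_add₀ (by norm_num), zpow_neg, zpow_natCast, zpow_one] at this
      linarith
    have h3 : mu (support u) ^ e ≤ ENNReal.ofReal (6 ^ e * T⁻¹) := by
      refine (ENNReal.rpow_le_rpow h2 he0).trans_eq ?_
      rw [ENNReal.ofReal_rpow_of_nonneg (by positivity) he0, Real.mul_rpow (by norm_num)
        (by positivity), Real.inv_rpow (by positivity)]
    calc ENNReal.ofReal (a * T) = ENNReal.ofReal (a * T) * 1 := (mul_one _).symm
      _ ≤ ENNReal.ofReal (a * T) * (eLpNorm u (2 * k : ℕ) mu * ENNReal.ofReal (6 ^ e * T⁻¹)) := by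
        gcongr
        exact h1.trans (by gcongr)
      _ = ENNReal.ofReal (a * 6 ^ e) * eLpNorm u (2 * k : ℕ) mu := by
        rw [mul_left_comm, ← ENNReal.ofReal_mul (by positivity), mul_comm]
        congr 2
        field_simp
      _ ≤ _ := by
        gcongr
        exact ENNReal.ofReal_le_ofReal (le_add_of_nonneg_left (by positivity))

lemma Comparable.trans {C C' : ℝ≥0} {a b d : ℝ≥0∞} (h : Comparable C a b)
    (h' : Comparable C' b d) : Comparable (C * C') a d := by
  constructor
  · rw [ENNReal.coe_mul, mul_assoc]
    exact h.1.trans (by gcongr; exact h'.1)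
  · rw [ENNReal.coe_mul, mul_comm (C : ℝ≥0∞), mul_assoc]
    exact h'.2.trans (by gcongr; exact h.2)

lemma Comparable.symm {C : ℝ≥0} {a b : ℝ≥0∞} (h : Comparable C a b) : Comparable C b a :=
  ⟨h.2, h.1⟩

/-- The embedding `H^{σ_q} ⊆ L^q` is saturated by localized eigenfunctions. -/
lemma embedding_saturated {c : ℝ} (hc : 0 < c) :
    ∃ C₀ : ℝ≥0, ∀ k : ℕ, 2 < 2 * k → ∃ C : ℝ≥0,
      ∀ j : ℕ, 2 ≤ j → ∀ ψ : Plane → ℝ, IsLocalizedEigenfunction c j ψ →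
        ∀ D ∈ ({neumannDomain, dirichletDomain} : Set (Set (Plane → ℝ))),
          Comparable C (eLpNorm ψ (2 * k : ℕ) mu) (sobolevNorm D (sobolevExp (2 * k)) ψ) ∧
            Comparable C₀ (sobolevNorm D (sobolevExp (2 * k)) ψ)
              (ENNReal.ofReal ((c * 5 ^ j) ^ (sobolevExp (2 * k) / 2))) := by
  refine ⟨((1 + 1 / c) ^ (spectralDim / 4)).toNNReal, fun k hk => ?_⟩
  have hk1 : 1 ≤ k := by omega
  obtain ⟨C, hC⟩ := exists_eLpNorm_comparable hc hk1
  refine ⟨C * ((1 + 1 / c) ^ (spectralDim / 4)).toNNReal, fun j _ ψ hψ D hD => ?_⟩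
  have hq : (2 : ℝ) ≤ 2 * k := by
    have : (1 : ℝ) ≤ k := by exact_mod_cast hk1
    linarith
  have key : Comparable ((1 + 1 / c) ^ (spectralDim / 4)).toNNReal
      (sobolevNorm D (sobolevExp (2 * k)) ψ)
      (ENNReal.ofReal ((c * 5 ^ j) ^ (sobolevExp (2 * k) / 2))) := by
    rcases hD with rfl | rfl
    · exact sobolevNorm_comparable hc hq j subset_rfl hψ.neumann hψ.norm_eq
    · exact sobolevNorm_comparable hc hq j dirichletDomain_subset hψ.dirichlet hψ.norm_eq
  exact ⟨(hC j ψ hψ).trans key.symm, key⟩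

/-! ### The eigenvalues of spectral decimation -/

lemma decimationEigenvalue_bounds (n : ℕ) :
    0 < decimationEigenvalue (n + 1) ∧ decimationEigenvalue (n + 1) ≤ 3 ∧
      (decimationEigenvalue (n + 2) < 4 / 5 ∧ 0 < decimationEigenvalue (n + 2)) := by
  have key : ∀ x : ℝ, 0 < x → x ≤ 3 → (5 - √(25 - 4 * x)) / 2 < 4 / 5 ∧
      0 < (5 - √(25 - 4 * x)) / 2 := by
    intro x h0 h3
    have h1 : 17 / 5 < √(25 - 4 * x) := Real.lt_sqrt_of_sq_lt (by norm_num; linarith)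
    have h2 : √(25 - 4 * x) < 5 := (Real.sqrt_lt' (by norm_num)).2 (by linarith)
    constructor <;> linarith
  induction n with
  | zero =>
    have := key 3 (by norm_num) le_rfl
    simpa [decimationEigenvalue] using this
  | succ n ih =>
    have h3 : decimationEigenvalue (n + 2) ≤ 3 := by linarith [ih.2.2.1]
    exact ⟨ih.2.2.2, h3, key _ ih.2.2.2 h3⟩

lemma decimationEigenvalue_pos : ∀ n, 0 < decimationEigenvalue n
  | 0 => by norm_num [decimationEigenvalue]
  | n + 1 => (decimationEigenvalue_bounds n).1

lemma decimationEigenvalue_succ_lt (n : ℕ) : decimationEigenvalue (n + 2) < 4 / 5 :=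
  (decimationEigenvalue_bounds n).2.2.1

lemma decimationEigenvalue_succ_le (n : ℕ) : decimationEigenvalue (n + 1) ≤ 3 :=
  (decimationEigenvalue_bounds n).2.1

lemma decimationEigenvalue_succ_ne_two : ∀ n, 2 - decimationEigenvalue (n + 1) ≠ 0
  | 0 => by norm_num [decimationEigenvalue]
  | n + 1 => by linarith [decimationEigenvalue_succ_lt n]

lemma five_sub_decimationEigenvalue_pos (n : ℕ) : 0 < 5 - decimationEigenvalue (n + 1) := by
  linarith [decimationEigenvalue_succ_le n]

lemma decimationEigenvalue_mul (n : ℕ) :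
    decimationEigenvalue (n + 1) * (5 - decimationEigenvalue (n + 1)) = decimationEigenvalue n := by
  cases n with
  | zero => norm_num [decimationEigenvalue]
  | succ n =>
    have h := Real.sq_sqrt (show 0 ≤ 25 - 4 * decimationEigenvalue (n + 1) by
      linarith [decimationEigenvalue_succ_le n])
    rw [decimationEigenvalue]
    linear_combination -(1 / 4) * h

/-- The recursion t (5 - t) = s is almost linear for reciprocals: 5/s = 1/t + 1/(5 - t), where the
last term is at most 1/4 from the second step on. -/
lemma five_pow_mul_decimationEigenvalue_le (n : ℕ) : 5 ^ n * decimationEigenvalue n ≤ 20 := by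
  -- The summand 1/16 is the fixed point of y ↦ 5 y - 1/4, and 13/240 gives equality at the
  -- eigenvalue 3. The resulting bound 240/13 is below 20.
  have key : ∀ n, 5 ^ (n + 1) * (13 / 240) + 1 / 16 ≤ 1 / decimationEigenvalue (n + 1) := by
    intro n
    induction n with
    | zero => norm_num [decimationEigenvalue]
    | succ n ih =>
      have h1 := decimationEigenvalue_pos (n + 2)
      have h2 := decimationEigenvalue_succ_lt n
      have h3 : 5 / decimationEigenvalue (n + 1) =
          1 / decimationEigenvalue (n + 2) + 1 / (5 - decimationEigenvalue (n + 2)) := by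
        rw [← decimationEigenvalue_mul (n + 1)]
        have : 5 - decimationEigenvalue (n + 2) ≠ 0 := (five_sub_decimationEigenvalue_pos _).ne'
        field_simp
        ring
      have h4 : 1 / (5 - decimationEigenvalue (n + 2)) ≤ 1 / 4 :=
        one_div_le_one_div_of_le (by norm_num) (by linarith)
      have h5 : 5 / decimationEigenvalue (n + 1) = 5 * (1 / decimationEigenvalue (n + 1)) := by ring
      rw [pow_succ]
      change _ ≤ 1 / decimationEigenvalue (n + 2)
      linarith
  cases n with
  | zero => norm_num [decimationEigenvalue]
  | succ n =>
    have h := key n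
    have hp := decimationEigenvalue_pos (n + 1)
    rw [le_div_iff₀ hp] at h
    nlinarith

lemma exists_tendsto_decimationEigenvalue :
    ∃ L : ℝ, 0 < L ∧ Tendsto (fun n : ℕ => 5 ^ n * decimationEigenvalue n) atTop (𝓝 L) := by
  have hmono : Monotone fun n : ℕ => 5 ^ n * decimationEigenvalue n := by
    refine monotone_nat_of_le_succ fun n => ?_
    rw [pow_succ, mul_assoc]
    refine mul_le_mul_of_nonneg_left ?_ (by positivity)
    rw [← decimationEigenvalue_mul n]
    nlinarith [sq_nonneg (decimationEigenvalue (n + 1))]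
  have hb : BddAbove (Set.range fun n : ℕ => 5 ^ n * decimationEigenvalue n) :=
    ⟨20, by rintro _ ⟨n, rfl⟩; exact five_pow_mul_decimationEigenvalue_le n⟩
  refine ⟨_, ?_, tendsto_atTop_ciSup hmono hb⟩
  refine lt_of_lt_of_le ?_ (le_ciSup hb 0)
  norm_num [decimationEigenvalue]

/-! ### Spectral decimation and the weak eigenvalue equation -/

lemma sum_eq_of_distinct (x : Fin 3 → ℝ) {i k l : Fin 3} (h1 : i ≠ k) (h2 : k ≠ l) (h3 : i ≠ l) :
    ∑ r, x r = x i + x k + x l := by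
  rw [Fin.sum_univ_three]
  rcases fin_three_cases i with rfl | rfl | rfl <;>
    rcases fin_three_cases k with rfl | rfl | rfl <;>
    rcases fin_three_cases l with rfl | rfl | rfl <;>
    first | contradiction | ring

lemma exists_third : ∀ i k : Fin 3, i ≠ k → ∃ l, k ≠ l ∧ i ≠ l := by decide

/-- The values at the corners of a subcell: `extend t x i k` is the value at the midpoint of the
corners `i` and `k` of the spectral extension with parameter `t` of the corner values `x`. -/
noncomputable def spectralExtension (t : ℝ) (x : Fin 3 → ℝ) (i k : Fin 3) : ℝ :=
  if i = k then x i else ((2 - t) * (x i + x k) + 2 * ∑ r, x r) / ((2 - t) * (5 - t))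

lemma spectralExtension_comm (t : ℝ) (x : Fin 3 → ℝ) (i k : Fin 3) :
    spectralExtension t x i k = spectralExtension t x k i := by
  unfold spectralExtension
  by_cases h : i = k
  · rw [h]
  · rw [if_neg h, if_neg (Ne.symm h), add_comm (x i)]

/-- The defect of the one-sided eigenvalue equation at the corner `i` of a cell with corner values
`x`. -/
noncomputable def defect (t : ℝ) (x : Fin 3 → ℝ) (i : Fin 3) : ℝ :=
  3 * x i - ∑ k, x k - t / 2 * x i

/-- Spectral decimation: the defects at the new points cancel, and those at the old ones are
multiplied by a constant. -/
lemma sum_defect_spectralExtension {t : ℝ} (h2 : 2 - t ≠ 0) (h5 : 5 - t ≠ 0) (x : Fin 3 → ℝ)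
    (V : Fin 3 → Fin 3 → ℝ) (hV : ∀ i k, V i k = V k i) :
    ∑ l, ∑ i, V l i * defect t (spectralExtension t x l) i =
      (6 - t) / ((2 - t) * (5 - t)) * ∑ i, V i i * defect (t * (5 - t)) x i := by
  simp only [defect, spectralExtension, Fin.sum_univ_three, hV 1 0, hV 2 0, hV 2 1]
  simp only [Fin.isValue, if_true, Fin.reduceEq, if_false]
  field_simp
  ring

lemma IsDecimationFunction.extension_eq {j : ℕ} {a b : Fin 3} {u : Plane → ℝ}
    (hu : IsDecimationFunction j a b u) (n : ℕ) {w : List (Fin 3)} (hw : w.length = j + n)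
    (i k : Fin 3) :
    u (cell w (contr i (vertex k))) =
      spectralExtension (decimationEigenvalue (n + 1)) (fun r => u (cell w (vertex r))) i k := by
  unfold spectralExtension
  by_cases h : i = k
  · rw [if_pos h, h, contr_vertex]
  · obtain ⟨l, h1, h2⟩ := exists_third i k h
    rw [if_neg h, ← midpoint_vertex, hu.extension n w hw i k l h h1 h2,
      sum_eq_of_distinct _ h h1 h2]
    congr 1
    ring

/-- Row `i` of the seed lists the corner values of one cell of level j. For the eigenvalue 6 the
defect at each corner is minus this sum, so zero row sums are the eigenvalue equation at level j. -/
lemma sum_seed (b i : Fin 3) : ∑ k, seed b i k = 0 := by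
  rcases fin_three_cases i with rfl | rfl | rfl <;>
    rcases fin_three_cases b with rfl | rfl | rfl <;>
    simp [seed, Fin.sum_univ_three, Fin.reduceEq] <;> norm_num

lemma IsDecimationFunction.sum_initial {j : ℕ} {a b : Fin 3} {u : Plane → ℝ}
    (hu : IsDecimationFunction j a b u) {w : List (Fin 3)} (hw : w.length = j - 1) (i : Fin 3) :
    ∑ k, u (cell w (contr i (vertex k))) = 0 := by
  simp only [← midpoint_vertex, hu.initial w hw i]
  split_ifs
  · exact sum_seed b i
  · exact sum_seed a i
  · simp

lemma IsDecimationFunction.sum_defect {j : ℕ} (hj : 2 ≤ j) {a b : Fin 3} {u : Plane → ℝ}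
    (hu : IsDecimationFunction j a b u) (v : Plane → ℝ) (n : ℕ) :
    ∑ w : Fin (j + n) → Fin 3, ∑ i, v (cell (List.ofFn w) (vertex i)) *
      defect (decimationEigenvalue n) (fun r => u (cell (List.ofFn w) (vertex r))) i = 0 := by
  induction n with
  | zero =>
    obtain ⟨d, rfl⟩ := Nat.exists_eq_add_of_le' (show 1 ≤ j by omega)
    rw [add_zero, sum_word_succ d fun w => ∑ i, v (cell w (vertex i)) *
      defect (decimationEigenvalue 0) (fun r => u (cell w (vertex r))) i]
    refine Finset.sum_eq_zero fun w _ => Finset.sum_eq_zero fun l _ =>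
      Finset.sum_eq_zero fun i _ => ?_
    have h := hu.sum_initial (w := List.ofFn w) (by simp) l
    simp only [defect, cell_concat, h, decimationEigenvalue]
    ring
  | succ n ih =>
    rw [← add_assoc, sum_word_succ (j + n) fun w => ∑ i, v (cell w (vertex i)) *
      defect (decimationEigenvalue (n + 1)) (fun r => u (cell w (vertex r))) i]
    have h : ∀ w : Fin (j + n) → Fin 3, ∑ l, ∑ i, v (cell (List.ofFn w ++ [l]) (vertex i)) *
        defect (decimationEigenvalue (n + 1))
          (fun r => u (cell (List.ofFn w ++ [l]) (vertex r))) i =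
        (6 - decimationEigenvalue (n + 1)) / ((2 - decimationEigenvalue (n + 1)) *
          (5 - decimationEigenvalue (n + 1))) * ∑ i, v (cell (List.ofFn w) (vertex i)) *
            defect (decimationEigenvalue n) (fun r => u (cell (List.ofFn w) (vertex r))) i := by
      intro w
      have h1 := sum_defect_spectralExtension (decimationEigenvalue_succ_ne_two n)
        (five_sub_decimationEigenvalue_pos n).ne' (fun r => u (cell (List.ofFn w) (vertex r)))
        (fun l i => v (cell (List.ofFn w) (contr l (vertex i))))
        fun i k => by rw [contr_vertex_comm]
      simp only [contr_vertex] at h1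
      rw [← decimationEigenvalue_mul n, ← h1]
      simp only [cell_concat, hu.extension_eq n (w := List.ofFn w) (by simp)]
    simp only [h, ← Finset.mul_sum, ih, mul_zero]

lemma cell_form_eq (x y : Fin 3 → ℝ) (t : ℝ) :
    (1 / 2 : ℝ) * ∑ i, ∑ k, (x i - x k) * (y i - y k) =
      t / 2 * ∑ i, x i * y i + ∑ i, y i * defect t x i := by
  simp only [defect, Fin.sum_univ_three]
  ring

/-- The eigenvalue equation on the graphs, in weak form. -/
lemma IsDecimationFunction.graphForm_eq {j : ℕ} (hj : 2 ≤ j) {a b : Fin 3} {u : Plane → ℝ}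
    (hu : IsDecimationFunction j a b u) (v : Plane → ℝ) (n : ℕ) :
    graphForm (j + n) u v = decimationEigenvalue n / 2 * ∑ w : Fin (j + n) → Fin 3, ∑ i,
      u (cell (List.ofFn w) (vertex i)) * v (cell (List.ofFn w) (vertex i)) := by
  have h : ∀ w : Fin (j + n) → Fin 3, (1 / 2 : ℝ) * ∑ i, ∑ k,
      (u (cell (List.ofFn w) (vertex i)) - u (cell (List.ofFn w) (vertex k))) *
        (v (cell (List.ofFn w) (vertex i)) - v (cell (List.ofFn w) (vertex k))) = _ := fun w =>
    cell_form_eq (fun r => u (cell (List.ofFn w) (vertex r)))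
      (fun r => v (cell (List.ofFn w) (vertex r))) (decimationEigenvalue n)
  unfold graphForm
  simp only [h]
  rw [Finset.sum_add_distrib, hu.sum_defect hj, add_zero, Finset.mul_sum]

lemma IsDecimationFunction.rescaled_graphForm_eq {j : ℕ} (hj : 2 ≤ j) {a b : Fin 3}
    {u : Plane → ℝ} (hu : IsDecimationFunction j a b u) (v : Plane → ℝ) (n : ℕ) :
    (5 / 3) ^ (j + n) * graphForm (j + n) u v = 5 ^ j / 2 * (5 ^ n * decimationEigenvalue n) *
      ∑ i, (1 / 3) ^ (j + n) * ∑ w : Fin (j + n) → Fin 3,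
        u (cell (List.ofFn w) (vertex i)) * v (cell (List.ofFn w) (vertex i)) := by
  rw [hu.graphForm_eq hj, Finset.sum_comm, ← Finset.mul_sum, div_pow, div_pow, one_pow,
    pow_add 5 j n]
  ring

/-- The graph equation tested with `u` itself bounds the rescaled energies by the supremum of `u`,
because 5^n λ_{j+n} ≤ 20. -/
lemma IsDecimationFunction.mem_neumannDomain {j : ℕ} (hj : 2 ≤ j) {a b : Fin 3} {u : Plane → ℝ}
    (hu : IsDecimationFunction j a b u) : u ∈ neumannDomain := by
  obtain ⟨B, hB⟩ := exists_bound_of_continuousOn hu.continuousOn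
  refine ⟨hu.continuousOn, energy_ne_top_of_le (B := 5 ^ j / 2 * 20 * (3 * B ^ 2)) fun m => ?_⟩
  -- The formula holds from level j on; monotonicity covers the lower levels.
  refine (monotone_graphEnergy u (show m ≤ j + m by omega)).trans ?_
  simp only
  rw [← graphForm_self, hu.rescaled_graphForm_eq hj]
  have h1 : ∀ i : Fin 3, (1 / 3 : ℝ) ^ (j + m) * ∑ w : Fin (j + m) → Fin 3,
      u (cell (List.ofFn w) (vertex i)) * u (cell (List.ofFn w) (vertex i)) ≤ B ^ 2 := by
    intro i
    calc _ ≤ (1 / 3 : ℝ) ^ (j + m) * ∑ w : Fin (j + m) → Fin 3, B ^ 2 := by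
          gcongr with w
          rw [← sq]
          exact sq_le_sq' (abs_le.1 (hB _ (cell_vertex_mem_SG _ i))).1
            (abs_le.1 (hB _ (cell_vertex_mem_SG _ i))).2
      _ = _ := by
        simp only [Finset.sum_const, Finset.card_univ, Fintype.card_pi, Fintype.card_fin,
          Finset.prod_const, nsmul_eq_mul]
        push_cast
        rw [← mul_assoc, ← mul_pow]
        norm_num
  have h2 := Finset.sum_le_sum fun i (_ : i ∈ Finset.univ) => h1 i
  have h3 : 5 ^ m * decimationEigenvalue m ≤ 20 := five_pow_mul_decimationEigenvalue_le m
  have h4 := decimationEigenvalue_pos m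
  refine mul_le_mul (by gcongr) (h2.trans_eq ?_) ?_ (by positivity)
  · simp
  · exact Finset.sum_nonneg fun i _ => mul_nonneg (by positivity)
      (Finset.sum_nonneg fun w _ => mul_self_nonneg _)

/-- Functions obtained by spectral decimation satisfy the eigenvalue equation against the whole
Neumann domain. -/
lemma IsDecimationFunction.energyForm_eq {j : ℕ} (hj : 2 ≤ j) {a b : Fin 3} {u : Plane → ℝ}
    (hu : IsDecimationFunction j a b u) {L : ℝ}
    (hL : Tendsto (fun n : ℕ => 5 ^ n * decimationEigenvalue n) atTop (𝓝 L)) {v : Plane → ℝ}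
    (hv : v ∈ neumannDomain) : energyForm u v = 3 / 2 * L * 5 ^ j * ∫ x, u x * v x ∂mu := by
  have h1 := tendsto_graphForm (hu.mem_neumannDomain hj) hv
  rw [← tendsto_add_atTop_iff_nat j] at h1
  refine tendsto_nhds_unique h1 ?_
  have h2 : ∀ i ∈ (Finset.univ : Finset (Fin 3)), Tendsto (fun n : ℕ => (1 / 3 : ℝ) ^ (j + n) *
      ∑ w : Fin (j + n) → Fin 3,
        u (cell (List.ofFn w) (vertex i)) * v (cell (List.ofFn w) (vertex i)))
      atTop (𝓝 (∫ x, u x * v x ∂mu)) := fun i _ =>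
    (tendsto_mean_corner (hu.continuousOn.mul hv.1) i).comp
      ((tendsto_add_atTop_nat j).congr fun n => add_comm n j)
  -- Each of the three corner labels contributes the full integral in the limit, whence the factor
  -- 3/2.
  convert ((hL.const_mul (5 ^ j / 2)).mul (tendsto_finsetSum _ h2)) using 2 with n
  · rw [add_comm n j, hu.rescaled_graphForm_eq hj]
  · simp only [Finset.sum_const, Finset.card_univ, Fintype.card_fin, nsmul_eq_mul]
    push_cast
    ring

lemma IsDecimationFunction.vertex_eq_zero {j : ℕ} (hj : 2 ≤ j) {a b : Fin 3} (hab : a ≠ b)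
    {u : Plane → ℝ} (hu : IsDecimationFunction j a b u) (i : Fin 3) : u (vertex i) = 0 := by
  have h := hu.initial (List.replicate (j - 1) i) (by simp) i i
  rw [midpoint_self, cell_replicate_vertex] at h
  rw [h]
  obtain ⟨d, rfl⟩ := Nat.exists_eq_add_of_le' hj
  rw [show d + 2 - 1 = d + 1 from rfl, List.replicate_succ]
  split_ifs with h1 h2
  · obtain ⟨rfl, -⟩ := List.cons.inj h1
    simp [seed, hab]
  · obtain ⟨rfl, -⟩ := List.cons.inj h2
    simp [seed, hab.symm]
  · rfl

lemma IsDecimationFunction.solvesEigenEq {j : ℕ} (hj : 2 ≤ j) {a b : Fin 3} (hab : a ≠ b)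
    {u : Plane → ℝ} (hu : IsDecimationFunction j a b u) {L : ℝ}
    (hL : Tendsto (fun n : ℕ => 5 ^ n * decimationEigenvalue n) atTop (𝓝 L)) :
    SolvesEigenEq neumannDomain (3 / 2 * L * 5 ^ j) u ∧
      SolvesEigenEq dirichletDomain (3 / 2 * L * 5 ^ j) u :=
  ⟨⟨hu.mem_neumannDomain hj, fun _ hv => hu.energyForm_eq hj hL hv⟩,
    ⟨hu.mem_neumannDomain hj, hu.vertex_eq_zero hj hab⟩,
    fun _ hv => hu.energyForm_eq hj hL hv.1⟩

/-! ### Supremum and oscillation under the spectral extension -/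

lemma spectralExtension_self (t : ℝ) (x : Fin 3 → ℝ) (i : Fin 3) :
    spectralExtension t x i i = x i := if_pos rfl

lemma spectralExtension_of_distinct (t : ℝ) (x : Fin 3 → ℝ) {i k l : Fin 3} (h1 : i ≠ k)
    (h2 : k ≠ l) (h3 : i ≠ l) : spectralExtension t x i k =
      ((4 - t) * (x i + x k) + 2 * x l) / ((2 - t) * (5 - t)) := by
  rw [spectralExtension, if_neg h1, sum_eq_of_distinct x h1 h2 h3]
  congr 1
  ring

/-- A crude factor, valid also for the first parameter 3. Growth like 2^n is harmless against
eigenvalues of order 5^{-n}. -/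
lemma abs_spectralExtension_le (n : ℕ) {x : Fin 3 → ℝ} {S : ℝ} (hx : ∀ i, |x i| ≤ S)
    (i k : Fin 3) : |spectralExtension (decimationEigenvalue (n + 1)) x i k| ≤ 2 * S := by
  have hS : 0 ≤ S := (abs_nonneg _).trans (hx 0)
  by_cases h : i = k
  · rw [h, spectralExtension_self]
    linarith [hx k]
  obtain ⟨l, h1, h2⟩ := exists_third i k h
  rw [spectralExtension_of_distinct _ _ h h1 h2]
  obtain ⟨hi, hi'⟩ := abs_le.1 (hx i)
  obtain ⟨hk, hk'⟩ := abs_le.1 (hx k)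
  obtain ⟨hl, hl'⟩ := abs_le.1 (hx l)
  cases n with
  | zero =>
    norm_num [decimationEigenvalue]
    rw [abs_le]
    constructor <;> linarith
  | succ n =>
    have ht := decimationEigenvalue_succ_lt n
    have ht0 := decimationEigenvalue_pos (n + 2)
    change |((4 - decimationEigenvalue (n + 2)) * (x i + x k) + 2 * x l) /
      ((2 - decimationEigenvalue (n + 2)) * (5 - decimationEigenvalue (n + 2)))| ≤ 2 * S
    set t := decimationEigenvalue (n + 2)
    have hD : 0 < (2 - t) * (5 - t) := mul_pos (by linarith) (by linarith)
    rw [abs_div, abs_of_pos hD, div_le_iff₀ hD]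
    have h3 : |(4 - t) * (x i + x k) + 2 * x l| ≤ (4 - t) * (2 * S) + 2 * S := by
      rw [abs_le]
      constructor <;> nlinarith
    refine h3.trans ?_
    nlinarith [mul_nonneg hS (mul_nonneg (sub_nonneg.2 ht.le) (by linarith : 0 ≤ 5 - t))]

/-- For t = 0 this is the harmonic extension, whose oscillation on subcells drops by the factor 3/5;
the dependence on t costs at most 3 t S. -/
lemma abs_corner_sub_le {t : ℝ} (ht0 : 0 < t) (ht : t < 4 / 5) {x : Fin 3 → ℝ} {S O : ℝ}
    (hx : ∀ i, |x i| ≤ S) (hO : ∀ i k, |x i - x k| ≤ O) (hOS : O ≤ 2 * S) {l k : Fin 3}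
    (h : l ≠ k) : |x l - spectralExtension t x l k| ≤ 3 / 5 * O + 3 * t * S := by
  obtain ⟨r, h1, h2⟩ := exists_third l k h
  rw [spectralExtension_of_distinct _ _ h h1 h2]
  have hS : 0 ≤ S := (abs_nonneg _).trans (hx 0)
  have hO0 : 0 ≤ O := (abs_nonneg _).trans (hO 0 0)
  have hD : 0 < (2 - t) * (5 - t) := mul_pos (by linarith) (by linarith)
  have hD5 : 5 ≤ (2 - t) * (5 - t) := by nlinarith
  have e : x l - ((4 - t) * (x l + x k) + 2 * x r) / ((2 - t) * (5 - t)) =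
      ((4 - t) * (x l - x k) + 2 * (x l - x r) + (t * (t - 5)) * x l) / ((2 - t) * (5 - t)) := by
    rw [eq_div_iff hD.ne', sub_mul, div_mul_cancel₀ _ hD.ne']
    ring
  have h3 : |(4 - t) * (x l - x k) + 2 * (x l - x r) + (t * (t - 5)) * x l| ≤
      (4 - t) * O + 2 * O + t * (5 - t) * S := by
    refine (abs_add_le _ _).trans (add_le_add ((abs_add_le _ _).trans (add_le_add ?_ ?_)) ?_)
    · rw [abs_mul, abs_of_pos (by linarith : 0 < 4 - t)]
      exact mul_le_mul_of_nonneg_left (hO l k) (by linarith)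
    · rw [abs_mul, abs_two]
      exact mul_le_mul_of_nonneg_left (hO l r) zero_le_two
    · rw [abs_mul, abs_mul, abs_of_pos ht0, abs_of_neg (by linarith : t - 5 < 0), neg_sub]
      exact mul_le_mul_of_nonneg_left (hx l) (mul_nonneg ht0.le (by linarith))
  rw [e, abs_div, abs_of_pos hD, div_le_iff₀ hD]
  refine h3.trans ?_
  have h4 : (4 - t) * O + 2 * O ≤ 3 / 5 * O * ((2 - t) * (5 - t)) + 16 / 5 * t * O := by
    nlinarith [mul_nonneg hO0 (sq_nonneg t)]
  have h5 : 16 / 5 * t * O ≤ 32 / 5 * t * S := by nlinarith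
  have h6 : t * (5 - t) * S ≤ 5 * t * S := by nlinarith [mul_nonneg hS (sq_nonneg t)]
  have h7 : 3 * t * S * 5 ≤ 3 * t * S * ((2 - t) * (5 - t)) :=
    mul_le_mul_of_nonneg_left hD5 (by positivity)
  have h8 : 0 ≤ t * S := by positivity
  rw [add_mul]
  nlinarith

/-- The oscillation on the subcells of the spectral extension. -/
lemma abs_spectralExtension_sub_le {t : ℝ} (ht0 : 0 < t) (ht : t < 4 / 5) {x : Fin 3 → ℝ} {S O : ℝ}
    (hx : ∀ i, |x i| ≤ S) (hO : ∀ i k, |x i - x k| ≤ O) (hOS : O ≤ 2 * S) (l i k : Fin 3) :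
    |spectralExtension t x l i - spectralExtension t x l k| ≤ 3 / 5 * O + 3 * t * S := by
  have hS : 0 ≤ S := (abs_nonneg _).trans (hx 0)
  have hO0 : 0 ≤ O := (abs_nonneg _).trans (hO 0 0)
  by_cases hik : i = k
  · rw [hik, sub_self, abs_zero]
    positivity
  by_cases hli : l = i
  · subst hli
    rw [spectralExtension_self]
    exact abs_corner_sub_le ht0 ht hx hO hOS hik
  by_cases hlk : l = k
  · subst hlk
    rw [spectralExtension_self, abs_sub_comm]
    exact abs_corner_sub_le ht0 ht hx hO hOS hli
  rw [spectralExtension_of_distinct t x hli hik hlk,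
    spectralExtension_of_distinct t x hlk (Ne.symm hik) hli]
  have h2 : 2 - t ≠ 0 := by linarith
  have h5 : 0 < 5 - t := by linarith
  have e : ((4 - t) * (x l + x i) + 2 * x k) / ((2 - t) * (5 - t)) -
      ((4 - t) * (x l + x k) + 2 * x i) / ((2 - t) * (5 - t)) = (x i - x k) / (5 - t) := by
    field_simp
    ring
  rw [e, abs_div, abs_of_pos h5, div_le_iff₀ h5]
  have h1 : 0 ≤ t * S := by positivity
  nlinarith [hO i k, mul_nonneg h1 h5.le]

/-! ### Construction of the decimation functions on codes -/

/-- The values prescribed at the corner `i` of the subcell `l` of the cell `w` of level `j - 1`. -/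
noncomputable def initialValue (j : ℕ) (a b : Fin 3) (w : List (Fin 3)) (l i : Fin 3) : ℝ :=
  if w = a :: List.replicate (j - 2) b then seed b l i
  else if w = b :: List.replicate (j - 2) a then seed a l i
  else 0

/-- The values at the corners of the cell of level `j + n` that is addressed by a sequence. -/
noncomputable def cornerValue (j : ℕ) (a b : Fin 3) (ω : ℕ → Fin 3) : ℕ → Fin 3 → ℝ
  | 0 => initialValue j a b (initialWord ω (j - 1)) (ω (j - 1))
  | n + 1 => spectralExtension (decimationEigenvalue (n + 1)) (cornerValue j a b ω n) (ω (j + n))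

variable {j : ℕ} {a b : Fin 3}

lemma seed_comm (b i k : Fin 3) : seed b i k = seed b k i := by
  unfold seed
  by_cases h : i = k
  · rw [h]
  · simp only [if_neg h, if_neg (Ne.symm h), or_comm]

lemma initialValue_comm (w : List (Fin 3)) (i k : Fin 3) :
    initialValue j a b w i k = initialValue j a b w k i := by
  simp only [initialValue, seed_comm _ i k]

lemma abs_initialValue_le (w : List (Fin 3)) (i k : Fin 3) : |initialValue j a b w i k| ≤ 2 := by
  unfold initialValue seed
  split_ifs <;> norm_num

lemma cornerValue_congr (hj : 2 ≤ j) {ω ω' : ℕ → Fin 3} (n : ℕ) (h : ∀ k < j + n, ω k = ω' k) :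
    cornerValue j a b ω n = cornerValue j a b ω' n := by
  induction n with
  | zero =>
    rw [cornerValue, cornerValue, h (j - 1) (by omega),
      initialWord_eq_iff.2 fun k hk => h k (by omega)]
  | succ n ih =>
    rw [cornerValue, cornerValue, h (j + n) (by omega), ih fun k hk => h k (by omega)]

lemma abs_cornerValue_le (ω : ℕ → Fin 3) (n : ℕ) (i : Fin 3) :
    |cornerValue j a b ω n i| ≤ 2 * 2 ^ n := by
  induction n generalizing i with
  | zero => simpa [cornerValue] using abs_initialValue_le _ _ i
  | succ n ih =>
    rw [pow_succ']
    refine (abs_spectralExtension_le n ih _ i).trans_eq ?_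
    ring

lemma abs_cornerValue_sub_le (ω : ℕ → Fin 3) (n : ℕ) (i k : Fin 3) :
    |cornerValue j a b ω n i - cornerValue j a b ω n k| ≤ 120 * (4 / 5) ^ n := by
  have h0 : ∀ n i k, |cornerValue j a b ω n i - cornerValue j a b ω n k| ≤ 2 * (2 * 2 ^ n) :=
    fun n i k => (abs_sub _ _).trans
      (by linarith [abs_cornerValue_le (j := j) (a := a) (b := b) ω n i,
        abs_cornerValue_le (j := j) (a := a) (b := b) ω n k])
  induction n generalizing i k with
  | zero => exact (h0 0 i k).trans (by norm_num)
  | succ n ih =>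
    cases n with
    | zero => exact (h0 1 i k).trans (by norm_num)
    | succ n =>
      have hb := five_pow_mul_decimationEigenvalue_le (n + 2)
      have h := abs_spectralExtension_sub_le (decimationEigenvalue_pos (n + 2))
        (decimationEigenvalue_succ_lt n) (abs_cornerValue_le ω (n + 1))
        -- The minimum secures the side condition O ≤ 2 S. The constant 120 closes the induction:
        -- 3/5 · 120 + 6 · 4 = 120 · 4/5.
        (O := min (120 * (4 / 5) ^ (n + 1)) (2 * (2 * 2 ^ (n + 1))))
        (fun i k => le_min (ih i k) (h0 (n + 1) i k)) (min_le_right _ _) (ω (j + (n + 1))) i k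
      refine h.trans ?_
      have h1 : decimationEigenvalue (n + 2) * 2 ^ (n + 1) ≤ 4 * (4 / 5) ^ (n + 1) := by
        have h2 : decimationEigenvalue (n + 2) * 5 ^ (n + 1) ≤ 4 := by
          rw [pow_succ 5 (n + 1)] at hb
          linarith
        have h3 : (2 : ℝ) ^ (n + 1) ≤ 4 ^ (n + 1) := pow_le_pow_left₀ (by norm_num) (by norm_num) _
        have h4 := decimationEigenvalue_pos (n + 2)
        rw [div_pow, ← mul_div_assoc, le_div_iff₀ (by positivity)]
        calc _ = decimationEigenvalue (n + 2) * 5 ^ (n + 1) * 2 ^ (n + 1) := by ring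
          _ ≤ 4 * 4 ^ (n + 1) := by gcongr
      rw [pow_succ (4 / 5 : ℝ) (n + 1)]
      have h2 := min_le_left (120 * (4 / 5 : ℝ) ^ (n + 1)) (2 * (2 * 2 ^ (n + 1)))
      linarith

lemma cornerValue_succ_of_eq (ω : ℕ → Fin 3) (n : ℕ) :
    cornerValue j a b ω (n + 1) (ω (j + n)) = cornerValue j a b ω n (ω (j + n)) :=
  spectralExtension_self _ _ _

lemma cornerValue_of_tail {ω : ℕ → Fin 3} {n : ℕ} {i : Fin 3} (h : ∀ k ≥ j + n, ω k = i) (m : ℕ) :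
    cornerValue j a b ω (n + m) i = cornerValue j a b ω n i := by
  induction m with
  | zero => rfl
  | succ m ih =>
    rw [← ih, ← h (j + (n + m)) (by omega)]
    exact cornerValue_succ_of_eq ω (n + m)

lemma dist_cornerValue_succ_le (ω : ℕ → Fin 3) (i : Fin 3) (n : ℕ) :
    dist (cornerValue j a b ω n i) (cornerValue j a b ω (n + 1) i) ≤ 240 * (4 / 5) ^ n := by
  have h1 := abs_cornerValue_sub_le (j := j) (a := a) (b := b) ω n i (ω (j + n))
  have h2 := abs_cornerValue_sub_le (j := j) (a := a) (b := b) ω (n + 1) (ω (j + n)) i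
  rw [cornerValue_succ_of_eq, pow_succ] at h2
  have h3 : (0 : ℝ) < (4 / 5) ^ n := by positivity
  rw [Real.dist_eq]
  refine (abs_sub_le _ (cornerValue j a b ω n (ω (j + n))) _).trans ?_
  linarith

/-- The value of the decimation function at the code of a sequence. -/
noncomputable def codeValue (j : ℕ) (a b : Fin 3) (ω : ℕ → Fin 3) : ℝ :=
  limUnder atTop fun n => cornerValue j a b ω n 0

lemma tendsto_cornerValue (ω : ℕ → Fin 3) (i : Fin 3) :
    Tendsto (fun n => cornerValue j a b ω n i) atTop (𝓝 (codeValue j a b ω)) := by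
  have h : Tendsto (fun n => cornerValue j a b ω n 0) atTop (𝓝 (codeValue j a b ω)) :=
    (cauchySeq_of_le_geometric _ _ (by norm_num) (dist_cornerValue_succ_le ω 0)).tendsto_limUnder
  have h2 : Tendsto (fun n => cornerValue j a b ω n i - cornerValue j a b ω n 0) atTop (𝓝 0) := by
    refine squeeze_zero_norm (fun n => abs_cornerValue_sub_le ω n i 0) ?_
    simpa using (tendsto_pow_atTop_nhds_zero_of_lt_one (r := (4 / 5 : ℝ)) (by norm_num)
      (by norm_num)).const_mul 120
  simpa using h2.add h

lemma codeValue_of_tail {ω : ℕ → Fin 3} {n : ℕ} {i : Fin 3} (h : ∀ k ≥ j + n, ω k = i) :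
    codeValue j a b ω = cornerValue j a b ω n i := by
  refine tendsto_nhds_unique (tendsto_cornerValue ω i) ?_
  refine tendsto_const_nhds.congr' ?_
  filter_upwards [eventually_ge_atTop n] with m hm
  obtain ⟨d, rfl⟩ := Nat.exists_eq_add_of_le hm
  exact (cornerValue_of_tail h d).symm

/-- A uniform limit of functions that depend on only j + n letters. -/
lemma continuous_codeValue (hj : 2 ≤ j) : Continuous (codeValue j a b) := by
  have hu : TendstoUniformly (fun n ω => cornerValue j a b ω n 0) (codeValue j a b) atTop := by
    rw [Metric.tendstoUniformly_iff]
    intro ε hε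
    have h0 : Tendsto (fun n : ℕ => 240 * (4 / 5 : ℝ) ^ n / (1 - 4 / 5)) atTop (𝓝 0) := by
      simpa using ((tendsto_pow_atTop_nhds_zero_of_lt_one (r := (4 / 5 : ℝ)) (by norm_num)
        (by norm_num)).const_mul 240).div_const (1 - 4 / 5)
    filter_upwards [h0.eventually_lt_const hε] with n hn ω
    rw [dist_comm]
    exact (dist_le_of_le_geometric_of_tendsto _ _ (by norm_num) (dist_cornerValue_succ_le ω 0)
      (tendsto_cornerValue ω 0) n).trans_lt hn
  refine hu.continuous (Frequently.of_forall fun n => ?_)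
  have h : (fun ω => cornerValue j a b ω n 0) = (fun w : Fin (j + n) → Fin 3 =>
      cornerValue j a b (constTail (List.ofFn w) 0) n 0) ∘ fun ω k => ω k := by
    ext1 ω
    refine congrFun (cornerValue_congr hj n fun k hk => ?_) 0
    simp [constTail, hk]
  rw [h]
  exact continuous_of_discreteTopology.comp (by fun_prop)

lemma initialWord_eq_cons_replicate {ω : ℕ → Fin 3} {d : ℕ} {a b : Fin 3} :
    initialWord ω (d + 1) = a :: List.replicate d b ↔ ω 0 = a ∧ ∀ k < d, ω (k + 1) = b := by
  rw [initialWord_succ', List.cons.injEq, List.eq_replicate_iff]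
  simp only [length_initialWord, true_and]
  simp only [initialWord, List.mem_ofFn]
  constructor
  · rintro ⟨h1, h2⟩
    exact ⟨h1, fun k hk => h2 _ ⟨⟨k, hk⟩, rfl⟩⟩
  · rintro ⟨h1, h2⟩
    refine ⟨h1, ?_⟩
    rintro _ ⟨k, rfl⟩
    exact h2 k k.2

open Classical in
-- At a vertex of V_{j-1} the prescribed value is 2 precisely when the sequence is one of the two
-- codes of p. This condition is invariant under exchanging the two codes of a point, as `swap_tail`
-- shows.
lemma initialValue_of_tail (hab : a ≠ b) {ω : ℕ → Fin 3} {d : ℕ} {i : Fin 3}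
    (h : ∀ k ≥ d + 1, ω k = i) :
    initialValue (d + 2) a b (initialWord ω (d + 1)) i i =
      if (ω 0 = a ∧ ∀ k, ω (k + 1) = b) ∨ (ω 0 = b ∧ ∀ k, ω (k + 1) = a) then 2 else 0 := by
  have full : ∀ c, i = c → (∀ k < d, ω (k + 1) = c) → ∀ k, ω (k + 1) = c := by
    rintro c rfl h1 k
    by_cases hk : k < d
    · exact h1 k hk
    · exact h (k + 1) (by omega)
  have last : ∀ c, (∀ k, ω (k + 1) = c) → i = c := fun c h1 => by
    rw [← h1 d, h (d + 1) le_rfl]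
  unfold initialValue
  rw [show d + 2 - 2 = d from rfl]
  simp only [initialWord_eq_cons_replicate, seed, if_true]
  split_ifs with h1 h2 h3 h3 h4 h5 h6 h6 h7
  · rfl
  · exact absurd (Or.inl ⟨h1.1, full b h2 h1.2⟩) h3
  · rcases h3 with h3 | h3
    · exact absurd (last b h3.2) h2
    · exact absurd (h1.1.symm.trans h3.1) hab
  · rfl
  · rfl
  · exact absurd (Or.inr ⟨h4.1, full a h5 h4.2⟩) h6
  · rcases h6 with h6 | h6
    · exact absurd (h6.1.symm.trans h4.1) hab
    · exact absurd (last a h6.2) h5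
  · rfl
  · rcases h7 with h7 | h7
    · exact absurd ⟨h7.1, fun k _ => h7.2 k⟩ h1
    · exact absurd ⟨h7.1, fun k _ => h7.2 k⟩ h4
  · rfl

lemma swap_tail {ω ω' : ℕ → Fin 3} {N : ℕ} (hN : ω N ≠ ω' N) (h3 : ∀ k > N, ω k = ω' N)
    (h4 : ∀ k > N, ω' k = ω N) {a b : Fin 3} (h : ω 0 = a ∧ ∀ k, ω (k + 1) = b) :
    ω' 0 = b ∧ ∀ k, ω' (k + 1) = a := by
  cases N with
  | zero => exact ⟨by rw [← h3 1 one_pos, h.2 0], fun k => by rw [h4 _ (Nat.succ_pos k), h.1]⟩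
  | succ N =>
    refine absurd ?_ hN
    rw [h.2 N, ← h3 (N + 2) (by omega), h.2 (N + 1)]

lemma codeValue_eq_of_junction (hj : 2 ≤ j) (hab : a ≠ b) {ω ω' : ℕ → Fin 3} {N : ℕ}
    (hlt : ∀ k < N, ω k = ω' k) (hN : ω N ≠ ω' N) (h3 : ∀ k > N, ω k = ω' N)
    (h4 : ∀ k > N, ω' k = ω N) : codeValue j a b ω = codeValue j a b ω' := by
  obtain ⟨d, rfl⟩ := Nat.exists_eq_add_of_le' hj
  -- The index N where the codes separate tells when the junction point appears: as a vertex of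
  -- V_{j-1}, as a midpoint filled by the seed, or as a midpoint filled by a spectral extension. The
  -- last two cases rest on symmetry in the two corners.
  rcases lt_trichotomy N (d + 1) with hd | rfl | hd
  · rw [codeValue_of_tail (n := 0) fun k hk => h3 k (by omega),
      codeValue_of_tail (n := 0) fun k hk => h4 k (by omega)]
    change initialValue (d + 2) a b (initialWord ω (d + 1)) (ω (d + 1)) _ =
      initialValue (d + 2) a b (initialWord ω' (d + 1)) (ω' (d + 1)) _
    rw [h3 (d + 1) hd, h4 (d + 1) hd,
      initialValue_of_tail hab fun k hk => h3 k (by omega),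
      initialValue_of_tail hab fun k hk => h4 k (by omega)]
    congr 1
    refine propext ⟨fun h => ?_, fun h => ?_⟩
    · exact (h.imp (swap_tail hN h3 h4) (swap_tail hN h3 h4)).symm
    · exact (h.imp (swap_tail hN.symm h4 h3) (swap_tail hN.symm h4 h3)).symm
  · rw [codeValue_of_tail (n := 0) fun k hk => h3 k (by omega),
      codeValue_of_tail (n := 0) fun k hk => h4 k (by omega)]
    change initialValue (d + 2) a b (initialWord ω (d + 1)) (ω (d + 1)) _ =
      initialValue (d + 2) a b (initialWord ω' (d + 1)) (ω' (d + 1)) _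
    rw [initialWord_eq_iff.2 hlt, initialValue_comm]
  · obtain ⟨n, rfl⟩ := Nat.exists_eq_add_of_le (show d + 2 ≤ N by omega)
    rw [codeValue_of_tail (n := n + 1) fun k hk => h3 k (by omega),
      codeValue_of_tail (n := n + 1) fun k hk => h4 k (by omega), cornerValue, cornerValue,
      cornerValue_congr hj n hlt, spectralExtension_comm]

lemma exists_isDecimationFunction (hj : 2 ≤ j) (hab : a ≠ b) :
    ∃ u : Plane → ℝ, IsDecimationFunction j a b u := by
  obtain ⟨u, hcont, hu⟩ := exists_continuousOn_of_code (continuous_codeValue (a := a) (b := b) hj)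
    fun ω ω' N h1 h2 h3 h4 => codeValue_eq_of_junction hj hab h1 h2 h3 h4
  have hval : ∀ (n : ℕ) (w : List (Fin 3)) (i : Fin 3), w.length = j + n →
      u (cell w (vertex i)) = cornerValue j a b (constTail w i) n i := by
    intro n w i hw
    rw [← code_constTail, hu, codeValue_of_tail (n := n)]
    exact fun k hk => constTail_of_le (by omega) i
  have hletter : ∀ (w : List (Fin 3)) (i k : Fin 3),
      constTail (w ++ [i]) k w.length = i := by
    intro w i k
    simp [constTail]
  refine ⟨u, hcont, fun w hw i k => ?_, fun n w hw i k l h1 h2 h3 => ?_⟩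
  · rw [midpoint_vertex, ← cell_concat, hval 0 _ _ (by simp [hw]; omega), cornerValue, ← hw,
      initialWord_constTail_append, hletter]
    rfl
  · rw [midpoint_vertex, ← cell_concat, hval (n + 1) _ _ (by simp [hw]; omega), cornerValue, ← hw,
      hletter, spectralExtension_of_distinct _ _ h1 h2 h3]
    have hpre : ∀ r, cornerValue j a b (constTail (w ++ [i]) k) n r = u (cell w (vertex r)) := by
      intro r
      rw [hval n w r hw]
      refine congrFun (cornerValue_congr hj n ?_) r
      rw [← initialWord_eq_iff, ← hw, initialWord_constTail_append, initialWord_constTail]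
    rw [hpre, hpre, hpre]

/-! ### The support of a decimation function -/

lemma spectralExtension_zero (t : ℝ) (i k : Fin 3) : spectralExtension t (fun _ => 0) i k = 0 := by
  simp [spectralExtension]

/-- The corner `l` survives, and the two midpoint values determine the other two corners through a
linear system with determinant (4 - t)² - 4 = (2 - t)(6 - t). -/
lemma eq_zero_of_spectralExtension {t : ℝ} (h2 : 2 - t ≠ 0) (h5 : 5 - t ≠ 0) (h6 : 6 - t ≠ 0)
    {x : Fin 3 → ℝ} {l : Fin 3} (h : ∀ i, spectralExtension t x l i = 0) (i : Fin 3) : x i = 0 := by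
  have hl : x l = 0 := by rw [← spectralExtension_self t x l, h l]
  by_cases hi : l = i
  · rw [← hi, hl]
  obtain ⟨r, h1, h3⟩ := exists_third l i hi
  have e1 := h i
  have e2 := h r
  rw [spectralExtension_of_distinct t x hi h1 h3, hl, div_eq_zero_iff,
    or_iff_left (mul_ne_zero h2 h5)] at e1
  rw [spectralExtension_of_distinct t x h3 (Ne.symm h1) hi, hl, div_eq_zero_iff,
    or_iff_left (mul_ne_zero h2 h5)] at e2
  have e3 : (2 - t) * (6 - t) * x i = 0 := by linear_combination (4 - t) * e1 - 2 * e2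
  exact (mul_eq_zero.1 e3).resolve_left (mul_ne_zero h2 h6)

variable {d : ℕ} {u : Plane → ℝ}

lemma IsDecimationFunction.corner_succ {j : ℕ} (hu : IsDecimationFunction j a b u) (ω : ℕ → Fin 3)
    (n : ℕ) (i : Fin 3) : u (cell (initialWord ω (j + (n + 1))) (vertex i)) =
      spectralExtension (decimationEigenvalue (n + 1))
        (fun r => u (cell (initialWord ω (j + n)) (vertex r))) (ω (j + n)) i := by
  rw [← add_assoc, initialWord_succ, cell_concat, hu.extension_eq n (by simp)]

lemma IsDecimationFunction.corner_zero (hu : IsDecimationFunction (d + 2) a b u) (ω : ℕ → Fin 3)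
    (i : Fin 3) : u (cell (initialWord ω (d + 2)) (vertex i)) =
      initialValue (d + 2) a b (initialWord ω (d + 1)) (ω (d + 1)) i := by
  rw [initialWord_succ, cell_concat, ← midpoint_vertex, hu.initial _ (by simp)]
  rfl

lemma IsDecimationFunction.eq_zero_of_initialWord (hu : IsDecimationFunction (d + 2) a b u)
    {ω : ℕ → Fin 3} (h1 : initialWord ω (d + 1) ≠ a :: List.replicate d b)
    (h2 : initialWord ω (d + 1) ≠ b :: List.replicate d a) : u (code ω) = 0 := by
  have hz : ∀ n i, u (cell (initialWord ω (d + 2 + n)) (vertex i)) = 0 := by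
    intro n
    induction n with
    | zero =>
      intro i
      rw [add_zero, hu.corner_zero, initialValue, show d + 2 - 2 = d from rfl, if_neg h1, if_neg h2]
    | succ n ih =>
      intro i
      rw [hu.corner_succ]
      simp only [ih, spectralExtension_zero]
  refine tendsto_nhds_unique (((hu.continuousOn _ (code_mem_SG ω)).tendsto.comp
    (tendsto_cell_initialWord ω 0)).comp (tendsto_add_atTop_nat (d + 2))) ?_
  refine tendsto_const_nhds.congr fun n => ?_
  simp only [Function.comp_apply, add_comm n, hz]

lemma exists_seed_ne_zero (b l : Fin 3) : ∃ i, seed b l i ≠ 0 := by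
  by_cases h : l = b
  · exact ⟨b, by simp [seed, h]⟩
  · exact ⟨b, by simp [seed, h]⟩

/-- Every cell along the sequence has a corner with nonzero value, and these corners converge to the
point. -/
lemma IsDecimationFunction.code_mem_support (hu : IsDecimationFunction (d + 2) a b u)
    {ω : ℕ → Fin 3} (h : initialWord ω (d + 1) = a :: List.replicate d b ∨
      initialWord ω (d + 1) = b :: List.replicate d a) : code ω ∈ support u := by
  have hex : ∀ n, ∃ i, u (cell (initialWord ω (d + 2 + n)) (vertex i)) ≠ 0 := by
    intro n
    induction n with
    | zero =>
      simp only [add_zero, hu.corner_zero]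
      unfold initialValue
      rcases h with h | h
      · simpa only [h, show d + 2 - 2 = d from rfl, if_true] using exists_seed_ne_zero b (ω (d + 1))
      · rw [h, show d + 2 - 2 = d from rfl]
        by_cases hab : b :: List.replicate d a = a :: List.replicate d b
        · simpa only [if_pos hab] using exists_seed_ne_zero b (ω (d + 1))
        · simpa only [if_neg hab, if_true] using exists_seed_ne_zero a (ω (d + 1))
    | succ n ih =>
      by_contra! hcon
      obtain ⟨i, hi⟩ := ih
      refine hi ?_
      simp only [hu.corner_succ] at hcon
      exact eq_zero_of_spectralExtension (decimationEigenvalue_succ_ne_two n)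
        (five_sub_decimationEigenvalue_pos n).ne'
        (by linarith [decimationEigenvalue_succ_le n]) hcon i
  choose i hi using hex
  refine mem_closure_of_tendsto (f := fun n => cell (initialWord ω (d + 2 + n)) (vertex (i n)))
    (b := atTop) ?_ (Eventually.of_forall fun n => ⟨cell_vertex_mem_SG _ _, hi n⟩)
  rw [tendsto_iff_dist_tendsto_zero]
  refine squeeze_zero (fun _ => dist_nonneg) (fun n => ?_)
    (tendsto_two_mul_half_pow.comp (tendsto_add_atTop_nat (d + 2)))
  rw [dist_comm, Function.comp_apply, add_comm n]
  exact dist_code_cell_le ω _ _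

lemma IsDecimationFunction.support_subset (hu : IsDecimationFunction (d + 2) a b u) :
    support u ⊆ cell (a :: List.replicate d b) '' SG ∪ cell (b :: List.replicate d a) '' SG := by
  refine closure_minimal ?_ ((isCompact_cell_SG _).union (isCompact_cell_SG _)).isClosed
  rintro _ ⟨⟨ω, rfl⟩, hω⟩
  have hmem : ∀ w, initialWord ω (d + 1) = w → code ω ∈ cell w '' SG := by
    rintro _ rfl
    exact ⟨_, code_mem_SG _, (code_eq_cell (d + 1) ω).symm⟩
  by_contra hcon
  rw [Set.mem_union, not_or] at hcon
  exact hω (hu.eq_zero_of_initialWord (fun h => hcon.1 (hmem _ h)) fun h => hcon.2 (hmem _ h))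

lemma IsDecimationFunction.measure_support_le (hu : IsDecimationFunction (d + 2) a b u) :
    mu.real (support u) ≤ 2 * (1 / 3) ^ (d + 1) := by
  refine (measureReal_mono hu.support_subset).trans ((measureReal_union_le _ _).trans ?_)
  have h1 := mu_real_cell_le (a :: List.replicate d b)
  have h2 := mu_real_cell_le (b :: List.replicate d a)
  simp only [List.length_cons, List.length_replicate] at h1 h2
  linarith

lemma IsDecimationFunction.le_measure_support (hab : a ≠ b)
    (hu : IsDecimationFunction (d + 2) a b u) :
    2 * (1 / 3) ^ (d + 1) ≤ mu.real (support u) := by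
  have hlen : ∀ a b : Fin 3, (a :: List.replicate d b).length = d + 1 := by simp
  have hword : ∀ (a b : Fin 3), ∀ ω ∈ cylinder (constTail (a :: List.replicate d b) b) (d + 1),
      initialWord ω (d + 1) = a :: List.replicate d b := by
    intro a b ω hω
    rw [initialWord_eq_iff.2 hω]
    simpa only [hlen] using initialWord_constTail (a :: List.replicate d b) b
  have hreal : ∀ ω, codeMeasure.real (cylinder ω (d + 1)) = (1 / 3) ^ (d + 1) := by
    intro ω
    rw [measureReal_def, codeMeasure_cylinder]
    simp
  have hdisj : Disjoint (cylinder (constTail (a :: List.replicate d b) b) (d + 1))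
      (cylinder (constTail (b :: List.replicate d a) a) (d + 1)) := by
    rw [Set.disjoint_left]
    intro ω h1 h2
    have h3 := (hword a b ω h1).symm.trans (hword b a ω h2)
    exact hab (List.cons.inj h3).1
  rw [mu, map_measureReal_apply measurable_code
    (show MeasurableSet (support u) from isClosed_closure.measurableSet)]
  calc 2 * (1 / 3 : ℝ) ^ (d + 1) = codeMeasure.real
        (cylinder (constTail (a :: List.replicate d b) b) (d + 1) ∪
          cylinder (constTail (b :: List.replicate d a) a) (d + 1)) := by
        rw [measureReal_union hdisj (measurableSet_cylinder _ _), hreal, hreal]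
        ring
    _ ≤ _ := by
        refine measureReal_mono ?_
        rintro ω (hω | hω)
        · exact hu.code_mem_support (Or.inl (hword a b ω hω))
        · exact hu.code_mem_support (Or.inr (hword b a ω hω))

/-! ### Normalization and the main theorem -/

/-- A function of finite energy that vanishes almost everywhere vanishes on the gasket. -/
lemma eq_zero_of_eLpNorm_eq_zero (hu : u ∈ neumannDomain) (h : eLpNorm u 2 mu = 0) {x : Plane}
    (hx : x ∈ SG) : u x = 0 := by
  obtain ⟨A, -, hA⟩ := exists_sq_le
  rw [eLpNorm_eq_zero_iff (aestronglyMeasurable_of_continuousOn hu.1) two_ne_zero] at h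
  have hint : ∫ y, u y ^ 2 ∂mu = 0 := by
    rw [← integral_zero Plane ℝ (μ := mu)]
    refine integral_congr_ae (h.mono fun y hy => ?_)
    simp [hy]
  -- With vanishing L² norm only the energy term of the supremum bound remains, and it tends to zero
  -- with the size of the cell.
  have h2 : Tendsto (fun m : ℕ => A * ((3 / 5 : ℝ) ^ m * (energy u).toReal)) atTop (𝓝 0) := by
    simpa using ((tendsto_pow_atTop_nhds_zero_of_lt_one (r := (3 / 5 : ℝ)) (by norm_num)
      (by norm_num)).mul_const (energy u).toReal).const_mul A
  have h3 : u x ^ 2 ≤ 0 := ge_of_tendsto' h2 fun m => by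
    simpa [hint] using hA u hu m x hx
  exact pow_eq_zero_iff two_ne_zero |>.1 (le_antisymm h3 (sq_nonneg _))

/-- The value at p is 2. -/
lemma IsDecimationFunction.eLpNorm_ne_zero (hu : IsDecimationFunction (d + 2) a b u) :
    eLpNorm u 2 mu ≠ 0 := by
  intro h
  have h1 := hu.initial (a :: List.replicate d b) (by simp) b b
  rw [midpoint_self, eq_zero_of_eLpNorm_eq_zero (hu.mem_neumannDomain (by omega)) h
    (cell_vertex_mem_SG _ _)] at h1
  simp [seed] at h1

lemma IsDecimationFunction.isLocalizedEigenfunction {j : ℕ} (hj : 2 ≤ j) (hab : a ≠ b)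
    (hu : IsDecimationFunction j a b u) {L : ℝ}
    (hL : Tendsto (fun n : ℕ => 5 ^ n * decimationEigenvalue n) atTop (𝓝 L)) :
    IsLocalizedEigenfunction (3 / 2 * L) j (normalized u) := by
  obtain ⟨d, rfl⟩ := Nat.exists_eq_add_of_le' hj
  have h0 := hu.eLpNorm_ne_zero
  have htop : eLpNorm u 2 mu ≠ ⊤ := (memLp_of_continuousOn hu.continuousOn 2).eLpNorm_ne_top
  have hr : (eLpNorm u 2 mu).toReal ≠ 0 := ENNReal.toReal_ne_zero.2 ⟨h0, htop⟩
  have hsmul : normalized u = (eLpNorm u 2 mu).toReal⁻¹ • u := by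
    ext1 x
    rw [normalized, Pi.smul_apply, smul_eq_mul, div_eq_inv_mul]
  have hsupp : support (normalized u) = support u := by
    simp only [support, normalized, ne_eq, div_eq_zero_iff, or_iff_left hr]
  obtain ⟨hN, hD⟩ := hu.solvesEigenEq hj hab hL
  have hz : ((3 : ℝ) ^ (-((d + 2 : ℕ) : ℤ))) = (1 / 3) ^ (d + 1) * (1 / 3) := by
    rw [zpow_neg, zpow_natCast, ← pow_succ, one_div, inv_pow]
  have hpos : (0 : ℝ) < (1 / 3) ^ (d + 1) := by positivity
  refine ⟨?_, ?_, ?_, ?_, ?_⟩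
  · rw [hsmul]
    exact hN.smul subset_rfl (fun u hu c => smul_mem_neumannDomain hu c) _
  · rw [hsmul]
    exact hD.smul dirichletDomain_subset (fun u hu c => smul_mem_dirichletDomain hu c) _
  · rw [hsmul, eLpNorm_const_smul, enorm_inv hr, ← ofReal_norm, Real.norm_of_nonneg ENNReal.toReal_nonneg,
      ENNReal.ofReal_toReal htop, ENNReal.inv_mul_cancel h0 htop]
  -- Half the measure of the support is exactly 3^{-j+1}: the upper bound is attained and the lower
  -- one has a factor 3 to spare.
  · rw [hsupp, hz]
    linarith [hu.le_measure_support hab]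
  · rw [hsupp, zpow_add₀ (by norm_num), hz, zpow_one]
    linarith [hu.measure_support_le]

end Gasket

theorem mainTheorem3 :
    (∃ c : ℝ, 0 < c ∧ ∀ j : ℕ, 2 ≤ j → ∀ a b : Fin 3, a ≠ b →
      (∃ u : Gasket.Plane → ℝ, Gasket.IsDecimationFunction j a b u) ∧
      ∀ u : Gasket.Plane → ℝ, Gasket.IsDecimationFunction j a b u →
        Gasket.IsLocalizedEigenfunction c j (Gasket.normalized u)) ∧
    ∀ c : ℝ, 0 < c → ∃ C₀ : ℝ≥0, ∀ k : ℕ, 2 < 2 * k → ∃ C : ℝ≥0,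
      ∀ j : ℕ, 2 ≤ j → ∀ ψ : Gasket.Plane → ℝ, Gasket.IsLocalizedEigenfunction c j ψ →
        ∀ D ∈ ({Gasket.neumannDomain, Gasket.dirichletDomain} : Set (Set (Gasket.Plane → ℝ))),
          Gasket.Comparable C (eLpNorm ψ (2 * k : ℕ) Gasket.mu)
              (Gasket.sobolevNorm D (Gasket.sobolevExp (2 * k)) ψ) ∧
            Gasket.Comparable C₀ (Gasket.sobolevNorm D (Gasket.sobolevExp (2 * k)) ψ)
              (ENNReal.ofReal ((c * 5 ^ j) ^ (Gasket.sobolevExp (2 * k) / 2))) := by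
  refine ⟨?_, fun c hc => Gasket.embedding_saturated hc⟩
  obtain ⟨L, hL0, hL⟩ := Gasket.exists_tendsto_decimationEigenvalue
  exact ⟨3 / 2 * L, by positivity, fun j hj a b hab =>
    ⟨Gasket.exists_isDecimationFunction hj hab, fun u hu =>
      hu.isLocalizedEigenfunction hj hab hL⟩⟩
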